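/- Let $\Sigma_1,\Sigma_2\in\mathbb{R}^{d\times d}$ be (symmetric) positive definite matrices with $\Sigma_1\preceq\Sigma_2$, let $\Sigma_1^{1/2}\Sigma_2^{-1}\Sigma_1^{1/2}=U^\top\Lambda U$ with $U$ orthogonal and $\Lambda$ diagonal, and put $A^*=\Sigma_1^{1/2}U^\top(\Lambda^{-1}-I_d)^{1/2}$, all square roots being positive semidefinite. Let $\pi:\mathbb{R}^d\to[0,\infty]$ be a measurable (possibly improper) prior density. Write $N(z;\mu,\Sigma)$ for the density of the $d$-dimensional normal distribution with mean $\mu$ and covariance matrix $\Sigma$, and put $$m_\pi(z;\Sigma)=\int N(z;\mu,\Sigma)\,\pi(\mu)\,d\mu,\qquad \phi_\pi(\mu,\Sigma)=\int N(z;\mu,\Sigma)\log m_\pi(z;\Sigma)\,dz\in[-\infty,\infty].$$ A function $f:\mathbb{R}^d\to(-\infty,\infty]$ is called superharmonic if it is not identically $\infty$, is lower semicontinuous, and satisfies $f\ge w$ on $G$ whenever $G$ is a bounded open set, $w$ is continuous on $\overline{G}$ and harmonic on $G$, and $f\geq w$ on $\partial G$. (a) Suppose that $\Sigma_2-\Sigma_1$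 is positive definite (equivalently, $A^*$ is invertible) and that $\mu\mapsto\pi(A^*\mu)$ is superharmonic. Then $$\phi_\pi(\mu,\Sigma_1)\ \ge\ \phi_\pi(\mu,\Sigma_2)\qquad\text{for every }\mu\in\mathbb{R}^d,$$ where both sides are $<\infty$, and both are finite unless $\pi\equiv0$. If $\pi$ is not a constant function, then the inequality is strict for every $\mu$. (b) In general (that is, when $\Sigma_2-\Sigma_1$ may be singular), if $\mu\mapsto\pi(\nu+A^*\mu)$ is superharmonic for every $\nu\in\mathbb{R}^d$, then $\phi_\pi(\mu,\Sigma_1)\ge\phi_\pi(\mu,\Sigma_2)$ for every $\mu\in\mathbb{R}^d$. -/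

import Mathlib

open MeasureTheory
open scoped ENNReal Matrix MatrixOrder

noncomputable section

/-- `SuperharmonicOn f R`: the extended real-valued function `f` is superharmonic on the open set
`R ⊆ ℝ^d`: it never takes the value `-∞`, it is not identically `+∞` on any connected component
of `R`, it is lower semicontinuous on `R`, and it lies above every function that is continuous on
the closure of a relatively compact open set `G`, harmonic in `G`, and below `f` on the boundary
of `G`. -/
structure SuperharmonicOn {d : ℕ} (f : EuclideanSpace ℝ (Fin d) → EReal)
    (R : Set (EuclideanSpace ℝ (Fin d))) : Prop where
  isOpen : IsOpen R
  bot_lt : ∀ x ∈ R, ⊥ < f x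
  exists_ne_top : ∀ x ∈ R, ∃ y ∈ connectedComponentIn R x, f y ≠ ⊤
  lowerSemicontinuousOn : LowerSemicontinuousOn f R
  harmonic_le : ∀ (G : Set (EuclideanSpace ℝ (Fin d))) (w : EuclideanSpace ℝ (Fin d) → ℝ),
    IsOpen G → IsCompact (closure G) → closure G ⊆ R →
    ContinuousOn w (closure G) → InnerProductSpace.HarmonicOnNhd w G →
    (∀ x ∈ frontier G, (w x : EReal) ≤ f x) → ∀ x ∈ G, (w x : EReal) ≤ f x

/-- The density `N(z; μ, S)` of the `d`-dimensional normal distribution with mean `μ` and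
(positive definite) covariance matrix `S`. -/
def normalDensity {d : ℕ} (z μ : EuclideanSpace ℝ (Fin d)) (S : Matrix (Fin d) (Fin d) ℝ) : ℝ :=
  1 / ((2 * Real.pi) ^ ((d : ℝ) / 2) * Real.sqrt S.det) *
    Real.exp (-((z - μ).ofLp ⬝ᵥ (S⁻¹ *ᵥ (z - μ).ofLp)) / 2)

/-- The marginal `m_π(z; S) = ∫ N(z; μ, S) π(μ) dμ` of a (possibly improper, possibly somewhere
infinite) prior density `π`, with values in `[0, ∞]`. -/
def marginal {d : ℕ} (π : EuclideanSpace ℝ (Fin d) → ℝ≥0∞)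
    (z : EuclideanSpace ℝ (Fin d)) (S : Matrix (Fin d) (Fin d) ℝ) : ℝ≥0∞ :=
  ∫⁻ μ, ENNReal.ofReal (normalDensity z μ S) * π μ

/-- `φ_π(μ, S) = ∫ N(z; μ, S) log m_π(z; S) dz` as an extended real number: the integral of the
positive part of the logarithm minus the integral of its negative part, where `log 0 = -∞` and
`log ∞ = ∞`. -/
def phi {d : ℕ} (π : EuclideanSpace ℝ (Fin d) → ℝ≥0∞)
    (μ : EuclideanSpace ℝ (Fin d)) (S : Matrix (Fin d) (Fin d) ℝ) : EReal :=
  ((∫⁻ z, ENNReal.ofReal (normalDensity z μ S) *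
      (ENNReal.log (marginal π z S)).toENNReal : ℝ≥0∞) : EReal) -
  ((∫⁻ z, ENNReal.ofReal (normalDensity z μ S) *
      (-ENNReal.log (marginal π z S)).toENNReal : ℝ≥0∞) : EReal)

/-- The matrix `A* = S^{1/2} Uᵀ (Λ⁻¹ - I)^{1/2}`, where `Λ` is the diagonal matrix with diagonal
entries `l`, and square roots are positive semidefinite square roots. -/
def starMatrix {d : ℕ} (S U : Matrix (Fin d) (Fin d) ℝ) (l : Fin d → ℝ) :
    Matrix (Fin d) (Fin d) ℝ :=
  CFC.sqrt S * Uᵀ * CFC.sqrt ((Matrix.diagonal l)⁻¹ - 1)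

end

/-! ### Superharmonic functions tested against harmonic quadratics -/

section Harmonic

variable {d : ℕ}

local notation "E" => EuclideanSpace ℝ (Fin d)

/-! Write `D = S₂ - S₁`. Since `A*` times its transpose is `D` (`starMatrix_mul_transpose`), the law
`N(μ, S₂)` is that of `z + A* u` with `z ~ N(μ, S₁)` and `u` an independent standard normal vector.
Everything rests on the Gaussian super-mean-value inequality `E π(x + A* u) ≤ π x`.

Granting it, extra noise lowers marginals, `m(z; S₂) ≤ m(z; S₁)`, and averaging commutes with
forming marginals, so `E m(z + A* u; S₂) ≤ E m(z + A* u; S₁) = m(z; S₂) ≤ m(z; S₁)`. Jensen's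
inequality for the logarithm, applied in `u` for each `z` and then integrated over `z ~ N(μ, S₁)`,
is the claim (`phi_le_phi`). The positive and negative parts of the logarithm are kept on opposite
sides of inequalities in `ℝ≥0∞`, so no `∞ - ∞` occurs. Equality forces `m(·; S₂)` to be almost
everywhere constant, and injectivity of the Laplace transform then makes `π` constant
(`phi_lt_phi`).

The super-mean-value inequality (`SuperharmonicOn.lintegral_stdGaussian_le`) is proved from the
definition by a parabolic minimum principle: the heat evolution of a bounded, compactly supported,
upper semicontinuous minorant of `f` cannot cross `f`, because at a first crossing a quadratic of
positive Laplacian would touch `f` from below. The only harmonic functions needed are quadratic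
polynomials. -/

/-- The inner product as a continuous bilinear form. -/
noncomputable def realInnerBilin : E →L[ℝ] E →L[ℝ] ℝ := innerSL ℝ

@[simp]
lemma realInnerBilin_apply (v w : E) : realInnerBilin v w = inner ℝ v w := rfl

lemma fderiv_affine_add_quadratic (c : ℝ) (b : E →L[ℝ] ℝ) (B : E →L[ℝ] E →L[ℝ] ℝ) (x₀ : E) :
    fderiv ℝ (fun x => c + b (x - x₀) + B (x - x₀) (x - x₀)) =
      fun x => b + (B (x - x₀) + B.flip (x - x₀)) := by
  funext x
  have hid : HasFDerivAt (fun x : E => x - x₀) (ContinuousLinearMap.id ℝ E) x :=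
    (hasFDerivAt_id x).sub_const x₀
  have hB : HasFDerivAt (fun x : E => B (x - x₀)) B x := B.hasFDerivAt.comp x hid
  have hb : HasFDerivAt (fun x : E => b (x - x₀)) b x := b.hasFDerivAt.comp x hid
  refine ((hb.const_add c).add (hB.clm_apply hid)).fderiv.trans ?_
  ext v
  simp

/-- The Laplacian of a quadratic polynomial is twice the trace of its quadratic part. -/
lemma laplacian_affine_add_quadratic (c : ℝ) (b : E →L[ℝ] ℝ) (B : E →L[ℝ] E →L[ℝ] ℝ)
    (x₀ x : E) :
    Laplacian.laplacian (fun x => c + b (x - x₀) + B (x - x₀) (x - x₀)) x =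
      2 * ∑ i, B (EuclideanSpace.basisFun (Fin d) ℝ i) (EuclideanSpace.basisFun (Fin d) ℝ i) := by
  rw [InnerProductSpace.laplacian_eq_iteratedFDeriv_orthonormalBasis _
    (EuclideanSpace.basisFun (Fin d) ℝ)]
  simp only [iteratedFDeriv_two_apply, fderiv_affine_add_quadratic]
  have h : fderiv ℝ (fun x : E => b + (B (x - x₀) + B.flip (x - x₀))) x = B + B.flip := by
    have hid : HasFDerivAt (fun x : E => x - x₀) (ContinuousLinearMap.id ℝ E) x :=
      (hasFDerivAt_id x).sub_const x₀
    have h1 : HasFDerivAt (fun x : E => B (x - x₀)) B x := B.hasFDerivAt.comp x hid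
    have h2 : HasFDerivAt (fun x : E => B.flip (x - x₀)) B.flip x := B.flip.hasFDerivAt.comp x hid
    exact ((h1.add h2).const_add b).fderiv
  rw [h, Finset.mul_sum]
  refine Finset.sum_congr rfl fun i _ => ?_
  simp [two_mul]

lemma contDiff_affine_add_quadratic (c : ℝ) (b : E →L[ℝ] ℝ) (B : E →L[ℝ] E →L[ℝ] ℝ) (x₀ : E) :
    ContDiff ℝ 2 (fun x => c + b (x - x₀) + B (x - x₀) (x - x₀)) := by
  fun_prop

lemma harmonicOnNhd_affine_add_quadratic (c : ℝ) (b : E →L[ℝ] ℝ) (B : E →L[ℝ] E →L[ℝ] ℝ)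
    (x₀ : E) (G : Set E)
    (hB : ∑ i, B (EuclideanSpace.basisFun (Fin d) ℝ i) (EuclideanSpace.basisFun (Fin d) ℝ i) = 0) :
    InnerProductSpace.HarmonicOnNhd (fun x => c + b (x - x₀) + B (x - x₀) (x - x₀)) G := by
  intro x _
  constructor
  · exact (contDiff_affine_add_quadratic c b B x₀).contDiffAt
  · refine Filter.Eventually.of_forall fun y => ?_
    rw [laplacian_affine_add_quadratic, hB]
    simp

/-- A superharmonic function cannot be touched from below by a function whose second order Taylor
expansion has positive Laplacian. -/
lemma SuperharmonicOn.trace_nonpos_of_touching {f : E → EReal}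
    (hf : SuperharmonicOn f Set.univ) (x₀ : E) (c C : ℝ) (b : E →L[ℝ] ℝ)
    (B : E →L[ℝ] E →L[ℝ] ℝ) (hx₀ : f x₀ ≤ c)
    (h : ∀ v : E, ‖v‖ ≤ 1 → ((c + b v + B v v - C * ‖v‖ ^ 3 : ℝ) : EReal) ≤ f (x₀ + v)) :
    ∑ i, B (EuclideanSpace.basisFun (Fin d) ℝ i) (EuclideanSpace.basisFun (Fin d) ℝ i) ≤ 0 := by
  set τ := ∑ i, B (EuclideanSpace.basisFun (Fin d) ℝ i) (EuclideanSpace.basisFun (Fin d) ℝ i)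
    with hτ
  by_contra! hpos
  have hd : 0 < d := by
    rcases Nat.eq_zero_or_pos d with rfl | h0
    · simp [τ] at hpos
    · exact h0
  have hd' : (0 : ℝ) < d := by exact_mod_cast hd
  set κ := τ / d with hκ
  have hκ0 : 0 < κ := div_pos hpos hd'
  -- The radius makes the cubic error `C r³` at most `κ r² / 2` on the sphere, and stays in the
  -- range `‖v‖ ≤ 1` of `h`.
  set r : ℝ := min 1 (κ / (2 * (|C| + 1))) with hr
  have hr0 : 0 < r := lt_min one_pos (by positivity)
  have hr1 : r ≤ 1 := min_le_left _ _
  have hrC : C * r ≤ κ / 2 := by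
    have h1 : r ≤ κ / (2 * (|C| + 1)) := min_le_right _ _
    rw [le_div_iff₀ (by positivity)] at h1
    nlinarith [le_abs_self C]
  -- Removing the trace makes the quadratic harmonic and lowers it by `κ r²` on the sphere. Half of
  -- this pays for the cubic error, the other half lifts the centre value to `c + κ r² / 2 > f x₀`.
  set B' : E →L[ℝ] E →L[ℝ] ℝ := B - κ • realInnerBilin with hB'
  have htr : ∑ i, B' (EuclideanSpace.basisFun (Fin d) ℝ i)
      (EuclideanSpace.basisFun (Fin d) ℝ i) = 0 := by
    have : ∀ i, B' (EuclideanSpace.basisFun (Fin d) ℝ i) (EuclideanSpace.basisFun (Fin d) ℝ i) =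
        B (EuclideanSpace.basisFun (Fin d) ℝ i) (EuclideanSpace.basisFun (Fin d) ℝ i) - κ := by
      intro i
      simp [hB']
    simp_rw [this, Finset.sum_sub_distrib, ← hτ]
    simp [hκ]
    field_simp
    simp
  have hB'v : ∀ v, B' v v = B v v - κ * ‖v‖ ^ 2 := by
    intro v
    simp [hB']
  have hclosure : closure (Metric.ball x₀ r) ⊆ Metric.closedBall x₀ r :=
    Metric.closure_ball_subset_closedBall
  have key := hf.harmonic_le (Metric.ball x₀ r)
    (fun x => (c + κ / 2 * r ^ 2) + b (x - x₀) + B' (x - x₀) (x - x₀)) Metric.isOpen_ball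
    ((isCompact_closedBall x₀ r).of_isClosed_subset isClosed_closure hclosure)
    (Set.subset_univ _) (contDiff_affine_add_quadratic _ b B' x₀).continuous.continuousOn
    (harmonicOnNhd_affine_add_quadratic _ b B' x₀ _ htr) ?_ x₀ (Metric.mem_ball_self hr0)
  · have h2 := key.trans hx₀
    simp only [sub_self, map_zero, add_zero] at h2
    have h3 := EReal.coe_le_coe_iff.mp h2
    nlinarith [mul_pos hκ0 (pow_pos hr0 2)]
  · intro x hx
    have hx' : ‖x - x₀‖ = r := by
      have := Metric.frontier_ball_subset_sphere hx
      rwa [mem_sphere_iff_norm] at this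
    have h1 := h (x - x₀) (by rw [hx']; exact hr1)
    rw [add_sub_cancel] at h1
    refine le_trans (EReal.coe_le_coe_iff.mpr ?_) h1
    rw [hB'v, hx']
    nlinarith [mul_le_mul_of_nonneg_right hrC (sq_nonneg r)]

end Harmonic

/-! ### Gaussian measures: densities and convolution -/

section Gaussian

open ProbabilityTheory

variable {d : ℕ}

local notation "E" => EuclideanSpace ℝ (Fin d)

lemma normalDensity_nonneg (z μ : E) (S : Matrix (Fin d) (Fin d) ℝ) : 0 ≤ normalDensity z μ S := by
  unfold normalDensity; positivity

lemma normalDensity_pos (z μ : E) {S : Matrix (Fin d) (Fin d) ℝ} (hS : S.PosDef) :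
    0 < normalDensity z μ S := by
  have := hS.det_pos
  unfold normalDensity; positivity

lemma normalDensity_comm (z μ : E) (S : Matrix (Fin d) (Fin d) ℝ) :
    normalDensity z μ S = normalDensity μ z S := by
  unfold normalDensity
  rw [← neg_sub μ z, WithLp.ofLp_neg, Matrix.mulVec_neg, neg_dotProduct_neg]

lemma continuous_normalDensity (μ : E) (S : Matrix (Fin d) (Fin d) ℝ) :
    Continuous fun z : E => normalDensity z μ S := by
  unfold normalDensity
  simp only [dotProduct, Matrix.mulVec]
  fun_prop

lemma integrable_exp_neg_norm_sq_half : Integrable fun v : E => Real.exp (-(‖v‖ ^ 2 / 2)) := by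
  have h := (GaussianFourier.integrable_cexp_neg_mul_sq_norm_add (V := E) (b := (1 / 2 : ℂ))
    (by norm_num) 0 0).re
  refine h.congr (Filter.Eventually.of_forall fun v => ?_)
  have : (-(1 / 2 : ℂ) * (‖v‖ : ℂ) ^ 2 + 0 * (inner ℝ (0 : E) v : ℝ)) =
      ((-(‖v‖ ^ 2 / 2) : ℝ) : ℂ) := by push_cast; ring
  simp only [this, ← Complex.ofReal_exp]
  rfl

/-- The density of the standard Gaussian measure. -/
lemma stdGaussian_eq_withDensity :
    stdGaussian E = volume.withDensity fun v : E =>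
      ENNReal.ofReal (((2 * Real.pi) ^ ((d : ℝ) / 2))⁻¹ * Real.exp (-(‖v‖ ^ 2 / 2))) := by
  set K : ℝ := ((2 * Real.pi) ^ ((d : ℝ) / 2))⁻¹ with hK
  have hK0 : 0 < K := by positivity
  have hint : Integrable fun v : E => K * Real.exp (-(‖v‖ ^ 2 / 2)) :=
    integrable_exp_neg_norm_sq_half.const_mul K
  have hmeas : Measurable fun v : E => K * Real.exp (-(‖v‖ ^ 2 / 2)) := by fun_prop
  have : IsFiniteMeasure (volume.withDensity fun v : E =>
      ENNReal.ofReal (K * Real.exp (-(‖v‖ ^ 2 / 2)))) :=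
    isFiniteMeasure_withDensity_ofReal hint.2
  apply Measure.ext_of_charFun
  ext t
  rw [charFun_stdGaussian, charFun_apply, integral_withDensity_eq_integral_toReal_smul
    hmeas.ennreal_ofReal (by simp)]
  have h1 : ∀ v : E, (ENNReal.ofReal (K * Real.exp (-(‖v‖ ^ 2 / 2)))).toReal •
      Complex.exp ((inner ℝ v t : ℝ) * Complex.I) =
      (K : ℂ) * Complex.exp (-(1 / 2 : ℂ) * (‖v‖ : ℂ) ^ 2 + Complex.I * (inner ℝ t v : ℝ)) := by
    intro v
    rw [ENNReal.toReal_ofReal (by positivity), Complex.real_smul, Complex.exp_add,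
      real_inner_comm]
    push_cast
    rw [mul_comm Complex.I, mul_assoc]
    congr 3
    ring_nf
  simp_rw [h1]
  rw [integral_const_mul, GaussianFourier.integral_cexp_neg_mul_sq_norm_add (by norm_num)]
  have h2 : ((Real.pi : ℂ) / (1 / 2)) ^ ((Module.finrank ℝ E : ℂ) / 2) = ((K⁻¹ : ℝ) : ℂ) := by
    rw [hK, inv_inv, Complex.ofReal_cpow (by positivity)]
    simp
    congr 1
    ring
  rw [h2, ← mul_assoc, ← Complex.ofReal_mul, mul_inv_cancel₀ hK0.ne']
  simp
  congr 1
  ring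

lemma sqrt_mul_inv_mul_sqrt {S : Matrix (Fin d) (Fin d) ℝ} (hS : S.PosDef) :
    CFC.sqrt S * S⁻¹ * CFC.sqrt S = 1 := by
  have hQ : CFC.sqrt S * CFC.sqrt S = S := CFC.sqrt_mul_sqrt_self _ hS.posSemidef.nonneg
  have hdet : IsUnit (CFC.sqrt S).det := by
    have h : (CFC.sqrt S).det * (CFC.sqrt S).det = S.det := by rw [← Matrix.det_mul, hQ]
    refine isUnit_iff_ne_zero.mpr fun h0 => hS.det_pos.ne' ?_
    rw [← h, h0, zero_mul]
  conv_lhs => rw [← hQ]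
  rw [Matrix.mul_inv_rev, CFC.sqrt_mul_sqrt_self _ hS.posSemidef.nonneg, ← mul_assoc,
    Matrix.mul_nonsing_inv _ hdet, one_mul, Matrix.nonsing_inv_mul _ hdet]

lemma det_sqrt {S : Matrix (Fin d) (Fin d) ℝ} (hS : S.PosDef) :
    (CFC.sqrt S).det = Real.sqrt S.det := by
  have hQ : CFC.sqrt S * CFC.sqrt S = S := CFC.sqrt_mul_sqrt_self _ hS.posSemidef.nonneg
  have h0 : 0 ≤ (CFC.sqrt S).det :=
    (Matrix.nonneg_iff_posSemidef.mp (CFC.sqrt_nonneg S)).det_nonneg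
  rw [← hQ, Matrix.det_mul, Real.sqrt_mul_self h0, hQ]

lemma isSymm_sqrt (S : Matrix (Fin d) (Fin d) ℝ) : (CFC.sqrt S)ᵀ = CFC.sqrt S := by
  have := (Matrix.nonneg_iff_posSemidef.mp (CFC.sqrt_nonneg S)).isHermitian
  simpa [Matrix.IsHermitian, Matrix.conjTranspose_eq_transpose_of_trivial] using this

/-- `normalDensity` is the density of the multivariate Gaussian measure. -/
lemma lintegral_multivariateGaussian {S : Matrix (Fin d) (Fin d) ℝ} (hS : S.PosDef) (μ : E)
    {h : E → ℝ≥0∞} (hh : Measurable h) :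
    ∫⁻ z, h z ∂(multivariateGaussian μ S) = ∫⁻ z, ENNReal.ofReal (normalDensity z μ S) * h z := by
  set Q := CFC.sqrt S with hQ
  have hdet0 : 0 < Q.det := by rw [det_sqrt hS]; exact Real.sqrt_pos.mpr hS.det_pos
  have hnd : Measurable fun z : E => normalDensity z μ S := (continuous_normalDensity μ S).measurable
  rw [multivariateGaussian, lintegral_map hh (by fun_prop), stdGaussian_eq_withDensity,
    lintegral_withDensity_eq_lintegral_mul _ (by fun_prop) (by fun_prop)]
  set G : E → ℝ≥0∞ := fun v => ENNReal.ofReal (Q.det * normalDensity (μ + v) μ S) * h (μ + v)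
    with hG
  have hGm : Measurable G := by fun_prop
  have hdetL : LinearMap.det (Matrix.toEuclideanLin Q) = Q.det := by
    change LinearMap.det (Matrix.toLpLin 2 2 Q) = _
    rw [Matrix.toLpLin_eq_toLin, LinearMap.det_toLin]
  have h1 : ∀ u : E, ((fun v : E => ENNReal.ofReal (((2 * Real.pi) ^ ((d : ℝ) / 2))⁻¹ *
      Real.exp (-(‖v‖ ^ 2 / 2)))) * fun x => h (μ + (Matrix.toEuclideanCLM (𝕜 := ℝ) Q) x)) u =
      G (Matrix.toEuclideanLin Q u) := by
    intro u
    simp only [Pi.mul_apply, hG]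
    congr 2
    have h2 : (μ + Matrix.toEuclideanLin Q u - μ).ofLp ⬝ᵥ
        (S⁻¹ *ᵥ (μ + Matrix.toEuclideanLin Q u - μ).ofLp) = ‖u‖ ^ 2 := by
      rw [add_sub_cancel_left, EuclideanSpace.real_norm_sq_eq]
      simp only [Matrix.toLpLin_apply]
      have h4 : Q *ᵥ u.ofLp = u.ofLp ᵥ* Q := by
        rw [← Matrix.mulVec_transpose, hQ, isSymm_sqrt S]
      conv_lhs => enter [1]; rw [h4]
      rw [← Matrix.dotProduct_mulVec, Matrix.mulVec_mulVec, Matrix.mulVec_mulVec, hQ,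
        sqrt_mul_inv_mul_sqrt hS, Matrix.one_mulVec]
      simp [dotProduct, sq]
    change _ = Q.det * normalDensity (μ + Matrix.toEuclideanLin Q u) μ S
    unfold normalDensity
    rw [h2, hQ, det_sqrt hS]
    have := Real.sqrt_pos.mpr hS.det_pos
    field_simp
  rw [lintegral_congr h1]
  have h3 : ∫⁻ u, G (Matrix.toEuclideanLin Q u) = ENNReal.ofReal |Q.det⁻¹| * ∫⁻ v, G v := by
    rw [← lintegral_map hGm (by fun_prop), Measure.map_linearMap_addHaar_eq_smul_addHaar _
      (by rw [hdetL]; exact hdet0.ne'), lintegral_smul_measure, hdetL]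
    rfl
  rw [h3, ← lintegral_const_mul _ hGm]
  rw [← lintegral_add_left_eq_self (fun z => ENNReal.ofReal (normalDensity z μ S) * h z) μ]
  refine lintegral_congr fun v => ?_
  rw [hG]
  simp only
  rw [← mul_assoc, ← ENNReal.ofReal_mul (abs_nonneg _), abs_of_pos (inv_pos.mpr hdet0),
    inv_mul_cancel_left₀ hdet0.ne']

/-- The density is symmetric in point and mean, so the marginal is an expectation of `π` under a
Gaussian centred at `z`; convolution identities then replace density computations. -/
lemma marginal_eq_lintegral {S : Matrix (Fin d) (Fin d) ℝ} (hS : S.PosDef)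
    {π : E → ℝ≥0∞} (hπ : Measurable π) (z : E) :
    marginal π z S = ∫⁻ μ, π μ ∂(multivariateGaussian z S) := by
  rw [lintegral_multivariateGaussian hS z hπ, marginal]
  simp_rw [normalDensity_comm z]

/-- Characteristic functions multiply under convolution, and `A u` has covariance `A Aᵀ = D`.
Allowing semidefinite `S` covers `S = 0`, that is, a deterministic starting point. -/
lemma lintegral_multivariateGaussian_add {S D A : Matrix (Fin d) (Fin d) ℝ} (hS : S.PosSemidef)
    (hA : A * Aᵀ = D) (μ : E) {h : E → ℝ≥0∞} (hh : Measurable h) :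
    ∫⁻ z, h z ∂(multivariateGaussian μ (S + D)) =
      ∫⁻ z, ∫⁻ u, h (z + Matrix.toEuclideanCLM (𝕜 := ℝ) A u) ∂(stdGaussian E)
        ∂(multivariateGaussian μ S) := by
  have hD : D.PosSemidef := by
    rw [← hA, ← Matrix.conjTranspose_eq_transpose_of_trivial]
    exact Matrix.posSemidef_self_mul_conjTranspose A
  have key : multivariateGaussian μ (S + D) = (multivariateGaussian μ S) ∗
      ((stdGaussian E).map (Matrix.toEuclideanCLM (𝕜 := ℝ) A)) := by
    apply Measure.ext_of_charFun
    ext t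
    have h1 : charFun ((stdGaussian E).map (Matrix.toEuclideanCLM (𝕜 := ℝ) A)) t =
        charFun (stdGaussian E) (Matrix.toEuclideanCLM (𝕜 := ℝ) Aᵀ t) := by
      rw [charFun_apply, integral_map (by fun_prop) (by fun_prop), charFun_apply]
      refine integral_congr_ae (Filter.Eventually.of_forall fun u => ?_)
      have : inner ℝ (Matrix.toEuclideanCLM (𝕜 := ℝ) A u) t =
          inner ℝ u (Matrix.toEuclideanCLM (𝕜 := ℝ) Aᵀ t) := by
        simp [EuclideanSpace.inner_eq_star_dotProduct, Matrix.dotProduct_mulVec, Matrix.mulVec_transpose]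
      simp only [this]
    have h2 : ‖Matrix.toEuclideanCLM (𝕜 := ℝ) Aᵀ t‖ ^ 2 = t.ofLp ⬝ᵥ D *ᵥ t.ofLp := by
      rw [EuclideanSpace.real_norm_sq_eq, ← hA, ← Matrix.mulVec_mulVec, Matrix.dotProduct_mulVec,
        ← Matrix.mulVec_transpose]
      simp [dotProduct, sq]
    rw [charFun_conv, charFun_multivariateGaussian (hS.add hD), charFun_multivariateGaussian hS,
      h1, charFun_stdGaussian, ← Complex.exp_add, ← Complex.ofReal_pow, h2, Matrix.add_mulVec,
      dotProduct_add]
    congr 1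
    push_cast
    ring
  rw [key, Measure.lintegral_conv hh]
  refine lintegral_congr fun z => ?_
  rw [lintegral_map (by fun_prop) (by fun_prop)]

end Gaussian

/-! ### Expansions of the heat kernel in space and time -/

section HeatKernel

open ProbabilityTheory

variable {d : ℕ}

local notation "E" => EuclideanSpace ℝ (Fin d)

/-- For `|u| ≤ 1` this is Taylor's bound; for `|u| > 1` each of `1`, `u`, `u²` is at most `|u|³`, so
the left side is nonpositive. -/
lemma one_add_add_sq_sub_cube_le_exp (u : ℝ) : 1 + u + u ^ 2 / 2 - 3 * |u| ^ 3 ≤ Real.exp u := by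
  rcases le_or_gt |u| 1 with h | h
  · have h1 := Real.exp_bound h (n := 3) (by norm_num)
    simp [Finset.sum_range_succ, Nat.factorial] at h1
    have h2 := (abs_le.mp h1).1
    have h3 : 0 ≤ |u| ^ 3 := by positivity
    norm_num at h2
    linarith
  · have h1 := Real.exp_pos u
    have h2 : u ≤ |u| := le_abs_self u
    have h3 : u ^ 2 = |u| ^ 2 := (sq_abs u).symm
    have h4 : |u| ≤ |u| ^ 3 := le_self_pow₀ h.le (by norm_num)
    have h5 : |u| ^ 2 ≤ |u| ^ 3 := pow_le_pow_right₀ h.le (by norm_num)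
    nlinarith

/-- The heat kernel, that is, the density of the centered normal distribution with covariance
matrix `t • 1`. -/
noncomputable def heatKernel (t : ℝ) (z : E) : ℝ :=
  Real.exp (-((d : ℝ) / 2) * Real.log (2 * Real.pi * t) - ‖z‖ ^ 2 / (2 * t))

lemma heatKernel_pos (t : ℝ) (z : E) : 0 < heatKernel t z := Real.exp_pos _

lemma continuous_heatKernel (t : ℝ) : Continuous fun z : E => heatKernel t z := by
  unfold heatKernel; fun_prop

lemma heatKernel_le (t : ℝ) (ht : 0 ≤ t) (z : E) : heatKernel t z ≤ heatKernel t (0 : E) := by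
  unfold heatKernel
  apply Real.exp_le_exp.mpr
  have : 0 ≤ ‖z‖ ^ 2 / (2 * t) := by positivity
  simp
  linarith

/-- Moves a translation from the merely semicontinuous initial value onto the kernel, as an
exponential tilt. -/
lemma heatKernel_sub_right {t : ℝ} (ht : t ≠ 0) (z h : E) :
    heatKernel t (z - h) =
      heatKernel t z * Real.exp (inner ℝ z h / t - ‖h‖ ^ 2 / (2 * t)) := by
  unfold heatKernel
  rw [← Real.exp_add, norm_sub_sq_real]
  congr 1
  field_simp
  ring

/-- A first order expansion backwards in time, from `exp u ≥ 1 + u` and `log y ≥ 1 - 1 / y`. Being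
one-sided and valid for every `z`, it can be integrated without differentiating under the integral.
-/
lemma heatKernel_mul_le_heatKernel_sub {s t : ℝ} (hs : 0 ≤ s) (hst : s < t) (z : E) :
    heatKernel t z * (1 + s * ((d : ℝ) / (2 * t) - ‖z‖ ^ 2 / (2 * t * (t - s)))) ≤
      heatKernel (t - s) z := by
  have ht : 0 < t := hs.trans_lt hst
  have hts : 0 < t - s := sub_pos.mpr hst
  have h1 : heatKernel (t - s) z = heatKernel t z * Real.exp
      ((d : ℝ) / 2 * Real.log (t / (t - s)) - s * (‖z‖ ^ 2 / (2 * t * (t - s)))) := by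
    unfold heatKernel
    rw [← Real.exp_add, Real.log_mul (by positivity) hts.ne', Real.log_mul (by positivity) ht.ne',
      Real.log_div ht.ne' hts.ne']
    congr 1
    field_simp
    ring
  rw [h1]
  refine mul_le_mul_of_nonneg_left ?_ (heatKernel_pos t z).le
  refine le_trans ?_ (Real.add_one_le_exp _)
  have h2 := Real.one_sub_inv_le_log_of_pos (div_pos ht hts)
  have h3 : 1 - (t / (t - s))⁻¹ = s / t := by field_simp; ring
  rw [h3] at h2
  have h4 : (d : ℝ) / 2 * (s / t) ≤ (d : ℝ) / 2 * Real.log (t / (t - s)) := by gcongr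
  have h5 : (d : ℝ) / 2 * (s / t) = s * ((d : ℝ) / (2 * t)) := by field_simp
  linarith

/-- Rescaling by `√t`. The left form also makes sense at `t = 0`, the right one is suited to
expansions. -/
lemma integral_stdGaussian_add_smul {t : ℝ} (ht : 0 < t) (g : E → ℝ) (x : E) :
    ∫ u, g (x + Real.sqrt t • u) ∂(stdGaussian E) = ∫ z, heatKernel t z * g (x + z) := by
  rw [stdGaussian_eq_withDensity, integral_withDensity_eq_integral_toReal_smul (by fun_prop)
    (by simp)]
  have hs : 0 < Real.sqrt t := Real.sqrt_pos.mpr ht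
  have h1 : ∀ u : E, (ENNReal.ofReal (((2 * Real.pi) ^ ((d : ℝ) / 2))⁻¹ *
      Real.exp (-(‖u‖ ^ 2 / 2)))).toReal • g (x + Real.sqrt t • u) =
      (Real.sqrt t) ^ d * (fun z => heatKernel t z * g (x + z)) (Real.sqrt t • u) := by
    intro u
    have h2 : (2 * Real.pi) ^ ((d : ℝ) / 2) =
        Real.exp (((d : ℝ) / 2) * Real.log (2 * Real.pi)) := by
      rw [Real.rpow_def_of_pos (by positivity), mul_comm]
    have h3 : (Real.sqrt t) ^ d = Real.exp (((d : ℝ) / 2) * Real.log t) := by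
      rw [← Real.rpow_natCast, Real.rpow_def_of_pos hs, Real.log_sqrt ht.le]
      congr 1
      ring
    rw [ENNReal.toReal_ofReal (by positivity), smul_eq_mul, h2, h3, ← Real.exp_neg,
      ← Real.exp_add]
    simp only [heatKernel]
    rw [← mul_assoc, ← Real.exp_add, norm_smul, Real.norm_of_nonneg hs.le, mul_pow,
      Real.sq_sqrt ht.le, Real.log_mul (by positivity) ht.ne']
    congr 2
    field_simp
    ring
  simp_rw [h1]
  rw [integral_const_mul,
    Measure.integral_comp_smul volume (fun z => heatKernel t z * g (x + z)) (Real.sqrt t)]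
  simp only [finrank_euclideanSpace, Fintype.card_fin, smul_eq_mul]
  rw [abs_of_pos (by positivity), mul_inv_cancel_left₀ (by positivity)]

lemma integrable_smul_of_bounded_support {F : Type*} [NormedAddCommGroup F] [NormedSpace ℝ F]
    [SecondCountableTopology F]
    {ρ : E → ℝ} (hρ : Integrable ρ) {R : ℝ} (hR : ∀ z, R < ‖z‖ → ρ z = 0) {G : E → F}
    (hG : Continuous G) : Integrable fun z => ρ z • G z := by
  obtain ⟨M, hM⟩ := (isCompact_closedBall (0 : E) R).exists_bound_of_continuousOn hG.continuousOn
  refine (hρ.norm.mul_const M).mono' (hρ.aestronglyMeasurable.smul hG.aestronglyMeasurable)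
    (Filter.Eventually.of_forall fun z => ?_)
  rw [norm_smul]
  rcases le_or_gt ‖z‖ R with h | h
  · exact mul_le_mul_of_nonneg_left (hM z (by simpa using h)) (norm_nonneg _)
  · simp [hR z h]

/-- The second moment form of a compactly supported weight, as a continuous bilinear form. -/
lemma exists_bilin_eq_integral_inner_sq {ρ : E → ℝ} (hρ : Integrable ρ)
    {R : ℝ} (hR : ∀ z, R < ‖z‖ → ρ z = 0) :
    ∃ B : E →L[ℝ] E →L[ℝ] ℝ, ∀ v, B v v = ∫ z, ρ z * inner ℝ z v ^ 2 := by
  refine ⟨∑ i, ∑ j, (∫ z : E, ρ z * (z i * z j)) •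
    (EuclideanSpace.proj i : E →L[ℝ] ℝ).smulRight (EuclideanSpace.proj j : E →L[ℝ] ℝ),
    fun v => ?_⟩
  have h1 : ∀ z : E, ρ z * inner ℝ z v ^ 2 =
      ∑ i, ∑ j, (v i * v j) * (ρ z * (z i * z j)) := by
    intro z
    have : (inner ℝ z v : ℝ) = ∑ i, z i * v i := by
      simp [PiLp.inner_apply, mul_comm]
    rw [this, sq, Finset.sum_mul_sum, Finset.mul_sum]
    refine Finset.sum_congr rfl fun i _ => ?_
    rw [Finset.mul_sum]
    exact Finset.sum_congr rfl fun j _ => by ring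
  have hint : ∀ i j, Integrable fun z : E => (v i * v j) * (ρ z * (z i * z j)) := fun i j =>
    (integrable_smul_of_bounded_support hρ hR (G := fun z : E => z i * z j)
      (by fun_prop)).const_mul _
  simp_rw [h1]
  rw [integral_finsetSum _ fun i _ => integrable_finsetSum _ fun j _ => hint i j]
  simp only [sum_apply, smul_apply, ContinuousLinearMap.smulRight_apply, smul_eq_mul]
  refine Finset.sum_congr rfl fun i _ => ?_
  rw [integral_finsetSum _ fun j _ => hint i j]
  refine Finset.sum_congr rfl fun j _ => ?_
  rw [integral_const_mul, mul_comm]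
  rfl

/-- Second order Taylor expansion from below of a Gaussian tilt of a compactly supported
weight. -/
lemma exists_quadratic_le_integral_tilt {ρ : E → ℝ} (hρ : Integrable ρ) (hρ0 : ∀ z, 0 ≤ ρ z)
    {R : ℝ} (hR0 : 0 ≤ R) (hR : ∀ z, R < ‖z‖ → ρ z = 0) {t : ℝ} (ht : 0 < t) :
    ∃ (b : E →L[ℝ] ℝ) (B : E →L[ℝ] E →L[ℝ] ℝ) (C : ℝ),
      (∑ i, B (EuclideanSpace.basisFun (Fin d) ℝ i) (EuclideanSpace.basisFun (Fin d) ℝ i) =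
        (∫ z, ρ z * ‖z‖ ^ 2) / (2 * t ^ 2) - d * (∫ z, ρ z) / (2 * t)) ∧
      ∀ h : E, ‖h‖ ≤ 1 → (∫ z, ρ z) + b h + B h h - C * ‖h‖ ^ 3 ≤
        ∫ z, ρ z * Real.exp (inner ℝ z h / t - ‖h‖ ^ 2 / (2 * t)) := by
  set m := ∫ z, ρ z with hm
  have hm0 : 0 ≤ m := integral_nonneg hρ0
  obtain ⟨B₁, hB₁v⟩ := exists_bilin_eq_integral_inner_sq hρ hR
  set b₁ : E →L[ℝ] ℝ := ∫ z, ρ z • realInnerBilin z with hb₁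
  have hb₁v : ∀ v, b₁ v = ∫ z, ρ z * inner ℝ z v := by
    intro v
    rw [hb₁, ContinuousLinearMap.integral_apply
      (integrable_smul_of_bounded_support hρ hR realInnerBilin.continuous)]
    simp
  -- On the support of `ρ`, and for `‖h‖ ≤ 1`, the exponent of the tilt is at most `M ‖h‖` in
  -- absolute value.
  set M := R / t + 1 / (2 * t) with hM
  have hM0 : 0 ≤ M := by positivity
  -- `3 M³` bounds the error of the exponential, `R / (2 t²)` the cross term in half the square of
  -- the exponent.
  set C := 3 * M ^ 3 + R / (2 * t ^ 2) with hC
  refine ⟨(1 / t) • b₁, (1 / (2 * t ^ 2)) • B₁ - (m / (2 * t)) • realInnerBilin, C * m, ?_, ?_⟩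
  · simp only [sub_apply, smul_apply, hB₁v,
      realInnerBilin_apply, smul_eq_mul, Finset.sum_sub_distrib, ← Finset.mul_sum]
    rw [← integral_finsetSum (f := fun i z => ρ z *
      inner ℝ z (EuclideanSpace.basisFun (Fin d) ℝ i) ^ 2) _ fun i _ =>
      integrable_smul_of_bounded_support hρ hR
      (G := fun z => inner ℝ z (EuclideanSpace.basisFun (Fin d) ℝ i) ^ 2) (by fun_prop)]
    simp only [← Finset.mul_sum, OrthonormalBasis.sum_sq_inner_left, real_inner_self_eq_norm_sq,
      OrthonormalBasis.norm_eq_one]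
    simp
    ring
  · intro h hh
    have hint : ∀ G : E → ℝ, Continuous G → Integrable fun z => ρ z * G z := fun G hG =>
      integrable_smul_of_bounded_support hρ hR hG
    have hlow : m + ((1 / t) • b₁) h + ((1 / (2 * t ^ 2)) • B₁ - (m / (2 * t)) • realInnerBilin : E →L[ℝ] E →L[ℝ] ℝ) h h
        - C * m * ‖h‖ ^ 3 = ∫ z, ρ z * (1 + inner ℝ z h / t +
          (1 / (2 * t ^ 2) * inner ℝ z h ^ 2 - ‖h‖ ^ 2 / (2 * t)) - C * ‖h‖ ^ 3) := by
      have e : ∀ z : E, ρ z * (1 + inner ℝ z h / t +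
          (1 / (2 * t ^ 2) * inner ℝ z h ^ 2 - ‖h‖ ^ 2 / (2 * t)) - C * ‖h‖ ^ 3) =
          (1 / t) * (ρ z * inner ℝ z h) + (1 / (2 * t ^ 2)) * (ρ z * inner ℝ z h ^ 2) +
          (1 - ‖h‖ ^ 2 / (2 * t) - C * ‖h‖ ^ 3) * ρ z := by
        intro z; ring
      simp_rw [e]
      rw [integral_add, integral_add, integral_const_mul, integral_const_mul, integral_const_mul]
      · simp only [sub_apply, smul_apply, hB₁v, hb₁v,
          realInnerBilin_apply, smul_eq_mul, real_inner_self_eq_norm_sq, ← hm]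
        ring
      · exact (hint _ (by fun_prop)).const_mul _
      · exact (hint _ (by fun_prop)).const_mul _
      · exact ((hint _ (by fun_prop)).const_mul _).add ((hint _ (by fun_prop)).const_mul _)
      · exact hρ.const_mul _
    rw [hlow]
    refine integral_mono (hint _ (by fun_prop)) (hint _ (by fun_prop)) fun z => ?_
    rcases lt_or_ge R ‖z‖ with hz | hz
    · simp [hR z hz]
    refine mul_le_mul_of_nonneg_left ?_ (hρ0 z)
    set a : ℝ := inner ℝ z h with ha
    have habs : |a| ≤ R * ‖h‖ := (abs_real_inner_le_norm z h).trans (by gcongr)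
    set u := a / t - ‖h‖ ^ 2 / (2 * t) with hu
    have hu1 : |u| ≤ M * ‖h‖ := by
      have h1 : |a / t| ≤ R * ‖h‖ / t := by
        rw [abs_div, abs_of_pos ht]; gcongr
      have h2 : |‖h‖ ^ 2 / (2 * t)| ≤ ‖h‖ / (2 * t) := by
        rw [abs_of_nonneg (by positivity)]
        gcongr
        nlinarith [norm_nonneg h]
      calc |u| ≤ |a / t| + |‖h‖ ^ 2 / (2 * t)| := abs_sub _ _
        _ ≤ R * ‖h‖ / t + ‖h‖ / (2 * t) := add_le_add h1 h2
        _ = M * ‖h‖ := by rw [hM]; ring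
    have hu3 : |u| ^ 3 ≤ M ^ 3 * ‖h‖ ^ 3 := by
      rw [← mul_pow]; gcongr
    have hu2 : a ^ 2 / t ^ 2 - R * ‖h‖ ^ 3 / t ^ 2 ≤ u ^ 2 := by
      have e : u ^ 2 = a ^ 2 / t ^ 2 - a * ‖h‖ ^ 2 / t ^ 2 + (‖h‖ ^ 2 / (2 * t)) ^ 2 := by
        rw [hu]; field_simp; ring
      have h3 : a * ‖h‖ ^ 2 / t ^ 2 ≤ R * ‖h‖ ^ 3 / t ^ 2 := by
        refine div_le_div_of_nonneg_right ?_ (by positivity)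
        calc a * ‖h‖ ^ 2 ≤ (R * ‖h‖) * ‖h‖ ^ 2 := by gcongr; exact (le_abs_self a).trans habs
          _ = R * ‖h‖ ^ 3 := by ring
      have h4 : 0 ≤ (‖h‖ ^ 2 / (2 * t)) ^ 2 := by positivity
      linarith
    refine le_trans ?_ (one_add_add_sq_sub_cube_le_exp u)
    have e1 : 1 / (2 * t ^ 2) * a ^ 2 = (a ^ 2 / t ^ 2) / 2 := by field_simp
    have e2 : C * ‖h‖ ^ 3 = 3 * (M ^ 3 * ‖h‖ ^ 3) + (R * ‖h‖ ^ 3 / t ^ 2) / 2 := by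
      rw [hC]; field_simp
    rw [e1, e2]
    linarith

end HeatKernel

/-! ### The heat flow of a minorant stays below a superharmonic function -/

section HeatComparison

open ProbabilityTheory Filter Topology

variable {d : ℕ}

local notation "E" => EuclideanSpace ℝ (Fin d)

/-- The heat evolution of an upper semicontinuous bounded initial value is upper semicontinuous up
to the initial time. -/
lemma upperSemicontinuous_integral_stdGaussian {g : E → ℝ} (hg : UpperSemicontinuous g)
    (hg0 : ∀ x, 0 ≤ g x) {N : ℝ} (hgN : ∀ x, g x ≤ N) :
    UpperSemicontinuous fun p : E × ℝ =>
      ∫ u, g (p.1 + Real.sqrt p.2 • u) ∂(stdGaussian E) := by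
  have hgm : Measurable g := hg.measurable
  have hint : ∀ p : E × ℝ, Integrable (fun u => g (p.1 + Real.sqrt p.2 • u)) (stdGaussian E) :=
    fun p => Integrable.of_bound (hgm.comp (by fun_prop)).aestronglyMeasurable N (Eventually.of_forall fun u => by
      rw [Real.norm_of_nonneg (hg0 _)]; exact hgN _)
  have hpos : ∀ p : E × ℝ, 0 ≤ ∫ u, g (p.1 + Real.sqrt p.2 • u) ∂(stdGaussian E) :=
    fun p => integral_nonneg fun u => hg0 _
  have heq : ∀ p : E × ℝ, ENNReal.ofReal (∫ u, g (p.1 + Real.sqrt p.2 • u) ∂(stdGaussian E)) =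
      ∫⁻ u, ENNReal.ofReal (g (p.1 + Real.sqrt p.2 • u)) ∂(stdGaussian E) :=
    fun p => ofReal_integral_eq_lintegral_ofReal (hint p) (Eventually.of_forall fun u => hg0 _)
  intro p y hy
  by_contra hcon
  rw [not_eventually] at hcon
  obtain ⟨q, hq, hqy⟩ := exists_seq_forall_of_frequently hcon
  have h1 : ∀ n, ENNReal.ofReal y ≤
      ∫⁻ u, ENNReal.ofReal (g ((q n).1 + Real.sqrt (q n).2 • u)) ∂(stdGaussian E) := by
    intro n
    rw [← heq]
    exact ENNReal.ofReal_le_ofReal (not_lt.mp (hqy n))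
  -- The reverse Fatou lemma, with the constant `N` as dominating function, along a sequence on
  -- which the values stay at least `y`.
  have h2 := limsup_lintegral_le (μ := stdGaussian E)
    (f := fun n u => ENNReal.ofReal (g ((q n).1 + Real.sqrt (q n).2 • u)))
    (fun _ => ENNReal.ofReal N) (fun n => by fun_prop)
    (fun n => Eventually.of_forall fun u => ENNReal.ofReal_le_ofReal (hgN _)) (by simp)
  have h3 : ∀ u : E, limsup (fun n => ENNReal.ofReal (g ((q n).1 + Real.sqrt (q n).2 • u))) atTop ≤
      ENNReal.ofReal (g (p.1 + Real.sqrt p.2 • u)) := by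
    intro u
    refine le_of_forall_gt fun b hb => ?_
    rcases eq_or_ne b ⊤ with rfl | hbt
    · refine lt_of_le_of_lt (limsup_le_of_le (h := Eventually.of_forall fun n =>
        ENNReal.ofReal_le_ofReal (hgN _))) ENNReal.ofReal_lt_top
    obtain ⟨c, hc1, hc2⟩ := exists_between hb
    have hct : c ≠ ⊤ := (hc2.trans_le le_top).ne
    have h4 : g (p.1 + Real.sqrt p.2 • u) < c.toReal := by
      have := (ENNReal.ofReal_lt_iff_lt_toReal (hg0 _) hct).mp hc1
      exact this
    have h5 : Tendsto (fun n => (q n).1 + Real.sqrt (q n).2 • u) atTop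
        (𝓝 (p.1 + Real.sqrt p.2 • u)) := by
      have : Continuous fun p : E × ℝ => p.1 + Real.sqrt p.2 • u := by fun_prop
      exact (this.tendsto p).comp hq
    refine lt_of_le_of_lt (limsup_le_of_le (h := ?_)) hc2
    filter_upwards [h5.eventually (hg _ _ h4)] with n hn
    exact (ENNReal.ofReal_lt_iff_lt_toReal (hg0 _) hct).mpr hn |>.le
  have h6 : ENNReal.ofReal y ≤
      ENNReal.ofReal (∫ u, g (p.1 + Real.sqrt p.2 • u) ∂(stdGaussian E)) := by
    rw [heq]
    refine le_trans ?_ (h2.trans (lintegral_mono h3))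
    exact le_limsup_of_frequently_le (Frequently.of_forall h1)
  have h7 := (ENNReal.ofReal_le_ofReal_iff (hpos p)).mp h6
  exact absurd hy (not_lt.mpr h7)

/-- The heat evolution of a bounded compactly supported minorant of a nonnegative superharmonic
function stays below this function. -/
lemma SuperharmonicOn.integral_stdGaussian_le {f : E → ℝ≥0∞}
    (hf : SuperharmonicOn (fun x => (f x : EReal)) Set.univ) {g : E → ℝ}
    (hg : UpperSemicontinuous g) (hg0 : ∀ x, 0 ≤ g x) {N : ℝ} (hgN : ∀ x, g x ≤ N) {R : ℝ}
    (hgR : ∀ x, R < ‖x‖ → g x = 0) (hgf : ∀ x, ENNReal.ofReal (g x) ≤ f x) (x : E) {T : ℝ}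
    (hT : 0 ≤ T) :
    ENNReal.ofReal (∫ u, g (x + Real.sqrt T • u) ∂(stdGaussian E)) ≤ f x := by
  have hgm : Measurable g := hg.measurable
  set v : E × ℝ → ℝ := fun p => ∫ u, g (p.1 + Real.sqrt p.2 • u) ∂(stdGaussian E) with hv
  have hvusc : UpperSemicontinuous v := upperSemicontinuous_integral_stdGaussian hg hg0 hgN
  have hN0 : 0 ≤ N := (hg0 0).trans (hgN 0)
  have hvN : ∀ p, v p ≤ N := fun p => by
    have : v p ≤ ∫ _, N ∂(stdGaussian E) := integral_mono_of_nonneg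
      (Eventually.of_forall fun _ => hg0 _) (integrable_const N) (Eventually.of_forall fun _ => hgN _)
    simpa using this
  have hv0 : ∀ p, 0 ≤ v p := fun p => integral_nonneg fun _ => hg0 _
  have hlsc : LowerSemicontinuous f := by
    intro z y hy
    have h1 := (lowerSemicontinuousOn_univ_iff.mp hf.lowerSemicontinuousOn) z (y : EReal)
      (by simpa using hy)
    filter_upwards [h1] with w hw
    simpa using hw
  -- Truncating at the bound `N` of `v` makes `f` real-valued and loses nothing in the comparison
  -- with `v`.
  set fr : E → ℝ := fun z => (min (f z) (ENNReal.ofReal N)).toReal with hfr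
  have hfr_top : ∀ z, min (f z) (ENNReal.ofReal N) ≠ ⊤ := fun z =>
    ((min_le_right _ _).trans_lt ENNReal.ofReal_lt_top).ne
  have hfr0 : ∀ z, 0 ≤ fr z := fun z => ENNReal.toReal_nonneg
  have hfr_f : ∀ z, ENNReal.ofReal (fr z) ≤ f z := fun z => by
    rw [hfr, ENNReal.ofReal_toReal (hfr_top z)]; exact min_le_left _ _
  have hgfr : ∀ z, g z ≤ fr z := fun z => by
    rw [hfr, ← ENNReal.ofReal_le_iff_le_toReal (hfr_top z)]
    exact le_min (hgf z) (ENNReal.ofReal_le_ofReal (hgN z))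
  have hfrlsc : LowerSemicontinuous fr := by
    intro z y hy
    rcases lt_or_ge y 0 with hy0 | hy0
    · exact Eventually.of_forall fun w => hy0.trans_le (hfr0 w)
    · have h1 : ENNReal.ofReal y < min (f z) (ENNReal.ofReal N) :=
        (ENNReal.ofReal_lt_iff_lt_toReal hy0 (hfr_top z)).mpr hy
      filter_upwards [hlsc z _ (h1.trans_le (min_le_left _ _))] with w hw
      exact (ENNReal.ofReal_lt_iff_lt_toReal hy0 (hfr_top w)).mp
        (lt_min hw (h1.trans_le (min_le_right _ _)))
  suffices hmain : v (x, T) ≤ fr x from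
    (ENNReal.ofReal_le_ofReal hmain).trans (hfr_f x)
  by_contra! hcon
  -- The flow solves `∂ₜ v = Δ v / 2`. The penalty contributes `ε d` through half its Laplacian but
  -- `ε (d + 1)` through its time derivative; this gap gives the final contradiction.
  obtain ⟨ε, hε, hεlt⟩ : ∃ ε > 0, fr x - v (x, T) + ε * (‖x‖ ^ 2 + (d + 1) * T) < 0 := by
    set a := ‖x‖ ^ 2 + (d + 1) * T
    have ha : 0 ≤ a := by positivity
    refine ⟨(v (x, T) - fr x) / (2 * (a + 1)), div_pos (sub_pos.mpr hcon) (by positivity), ?_⟩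
    have : (v (x, T) - fr x) / (2 * (a + 1)) * a < v (x, T) - fr x := by
      rw [div_mul_eq_mul_div, div_lt_iff₀ (by positivity)]
      nlinarith [sub_pos.mpr hcon]
    linarith
  set F : E × ℝ → ℝ := fun p => (fr p.1 - v p) + ε * (‖p.1‖ ^ 2 + (d + 1) * p.2) with hF
  have hFlsc : LowerSemicontinuous F := by
    have h1 : LowerSemicontinuous fun p : E × ℝ => fr p.1 := hfrlsc.comp continuous_fst
    have h2 : LowerSemicontinuous fun p : E × ℝ => -v p := by
      intro p y hy
      filter_upwards [hvusc p (-y) (by linarith)] with q hq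
      linarith
    have h3 : LowerSemicontinuous fun p : E × ℝ => ε * (‖p.1‖ ^ 2 + (d + 1) * p.2) :=
      Continuous.lowerSemicontinuous (by fun_prop)
    have h4 := (h1.add h2).add h3
    simpa only [hF, sub_eq_add_neg] using h4
  -- Beyond `√(N / ε)` the penalty outweighs `v ≤ N`, so a negative minimum of `F` lies in a compact
  -- set; `‖x‖` ensures that `(x, T)` is in that set.
  set r : ℝ := max ‖x‖ (Real.sqrt (N / ε)) with hr
  have hfar : ∀ p : E × ℝ, 0 ≤ p.2 → r < ‖p.1‖ → 0 ≤ F p := by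
    intro p hp hrp
    have h1 : N / ε ≤ ‖p.1‖ ^ 2 := by
      have h2 : Real.sqrt (N / ε) ≤ ‖p.1‖ := (le_max_right _ _).trans hrp.le
      exact (Real.sqrt_le_left (norm_nonneg _)).mp h2
    rw [div_le_iff₀ hε] at h1
    have h3 : 0 ≤ ε * ((d + 1) * p.2) := by positivity
    simp only [hF]
    linarith [hvN p, hfr0 p.1]
  have hK : IsCompact (Metric.closedBall (0 : E) r ×ˢ Set.Icc 0 T) :=
    (isCompact_closedBall _ _).prod isCompact_Icc
  have hxK : (x, T) ∈ Metric.closedBall (0 : E) r ×ˢ Set.Icc 0 T :=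
    ⟨mem_closedBall_zero_iff.mpr (le_max_left _ _), hT, le_rfl⟩
  obtain ⟨⟨x₀, t⟩, ⟨-, ht0, htT⟩, hmin⟩ :=
    LowerSemicontinuousOn.exists_isMinOn ⟨_, hxK⟩ hK (hFlsc.lowerSemicontinuousOn _)
  simp only at ht0 htT
  have hFneg : F (x₀, t) < 0 := (hmin hxK).trans_lt hεlt
  have hminall : ∀ y s, 0 ≤ s → s ≤ T → F (x₀, t) ≤ F (y, s) := by
    intro y s hs hsT
    rcases le_or_gt ‖y‖ r with hy | hy
    · exact hmin ⟨by simpa using hy, hs, hsT⟩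
    · exact hFneg.le.trans (hfar (y, s) hs hy)
  have ht : 0 < t := by
    rcases ht0.eq_or_lt with rfl | h
    · exfalso
      have h1 : v (x₀, 0) = g x₀ := by simp [hv]
      have h2 : 0 ≤ ε * (‖x₀‖ ^ 2 + (d + 1) * 0) := by positivity
      simp only [hF, h1] at hFneg
      linarith [hgfr x₀]
    · exact h
  -- the weight
  set ρ : E → ℝ := fun z => heatKernel t z * g (x₀ + z) with hρ
  have hρ0 : ∀ z, 0 ≤ ρ z := fun z => mul_nonneg (heatKernel_pos t z).le (hg0 _)
  set R' := |R| + ‖x₀‖ with hR'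
  have hR'0 : 0 ≤ R' := by positivity
  have hρR : ∀ z, R' < ‖z‖ → ρ z = 0 := by
    intro z hz
    have h1 : R < ‖x₀ + z‖ := by
      have h2 : ‖z‖ ≤ ‖x₀ + z‖ + ‖x₀‖ := by
        calc ‖z‖ = ‖(x₀ + z) - x₀‖ := by rw [add_sub_cancel_left]
          _ ≤ _ := norm_sub_le _ _
      linarith [le_abs_self R]
    simp [hρ, hgR _ h1]
  have hsupp : ∀ z, z ∉ Metric.closedBall (0 : E) R' → g (x₀ + z) = 0 := by
    intro z hz
    have h1 := hρR z (by simpa using hz)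
    exact (mul_eq_zero.mp h1).resolve_left (heatKernel_pos t z).ne'
  have hgint : Integrable fun z => g (x₀ + z) := by
    have h1 : IntegrableOn (fun z => g (x₀ + z)) (Metric.closedBall (0 : E) R') :=
      Measure.integrableOn_of_bounded (M := N) (measure_closedBall_lt_top).ne
        (hgm.comp (by fun_prop)).aestronglyMeasurable
        (Eventually.of_forall fun z => by rw [Real.norm_of_nonneg (hg0 _)]; exact hgN _)
    exact (integrableOn_iff_integrable_of_support_subset fun z hz => by
      by_contra h; exact hz (hsupp z h)).mp h1
  have hρint : Integrable ρ := by
    refine hgint.bdd_mul (c := heatKernel t (0 : E))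
      (continuous_heatKernel t).aestronglyMeasurable (Eventually.of_forall fun z => ?_)
    rw [Real.norm_of_nonneg (heatKernel_pos t z).le]
    exact heatKernel_le t ht.le z
  set m := ∫ z, ρ z with hm
  set M := ∫ z, ρ z * ‖z‖ ^ 2 with hM
  have hM0 : 0 ≤ M := integral_nonneg fun z => mul_nonneg (hρ0 z) (by positivity)
  have hvm : v (x₀, t) = m := integral_stdGaussian_add_smul ht g x₀
  obtain ⟨b, B, C, htr, hexp⟩ := exists_quadratic_le_integral_tilt hρint hρ0 hR'0 hρR ht
  have hvh : ∀ h : E, v (x₀ + h, t) =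
      ∫ z, ρ z * Real.exp (inner ℝ z h / t - ‖h‖ ^ 2 / (2 * t)) := by
    intro h
    rw [hv]
    simp only
    rw [integral_stdGaussian_add_smul ht g (x₀ + h),
      ← integral_sub_right_eq_self (fun z => heatKernel t z * g (x₀ + h + z)) h]
    refine integral_congr_ae (Eventually.of_forall fun z => ?_)
    simp only [hρ]
    rw [heatKernel_sub_right ht.ne', add_assoc, add_sub_cancel]
    ring
  -- the space condition
  have hspace : M / (2 * t ^ 2) - d * m / (2 * t) - ε * d ≤ 0 := by
    -- The truncation is inactive at `x₀`: otherwise `fr x₀ = N ≥ v` and `F` would be nonnegative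
    -- there.
    have hfx₀ : f x₀ ≤ ENNReal.ofReal (fr x₀) := by
      rw [hfr, ENNReal.ofReal_toReal (hfr_top x₀)]
      refine le_min le_rfl ?_
      by_contra! hlt
      have h1 : fr x₀ = N := by
        simp only [hfr]
        rw [min_eq_right hlt.le, ENNReal.toReal_ofReal hN0]
      have h2 : 0 ≤ ε * (‖x₀‖ ^ 2 + (d + 1) * t) := by positivity
      simp only [hF, h1] at hFneg
      linarith [hvN (x₀, t)]
    -- Minimality at fixed time says that `v(·, t) - ε ‖·‖²`, up to a constant, touches `fr` from
    -- below at `x₀`; its lower Taylor polynomial therefore touches `f`.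
    have key := hf.trace_nonpos_of_touching x₀ (fr x₀) C (b - (2 * ε) • realInnerBilin x₀)
      (B - ε • realInnerBilin) ?_ ?_
    · simp only [sub_apply, smul_apply, Finset.sum_sub_distrib, htr, realInnerBilin_apply,
        real_inner_self_eq_norm_sq, OrthonormalBasis.norm_eq_one] at key
      simp at key
      linarith
    · have h1 : ((ENNReal.ofReal (fr x₀) : ℝ≥0∞) : EReal) = ((fr x₀ : ℝ) : EReal) := by
        rw [EReal.coe_ennreal_ofReal, max_eq_left (hfr0 x₀)]
      rw [← h1]
      exact_mod_cast hfx₀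
    · intro h hh
      have h1 := hminall (x₀ + h) t ht0 htT
      have h2 := hexp h hh
      rw [← hvh h] at h2
      simp only [hF, hvm] at h1
      rw [norm_add_sq_real] at h1
      have h3 : fr x₀ + (b - (2 * ε) • realInnerBilin x₀) h +
          (B - ε • realInnerBilin : E →L[ℝ] E →L[ℝ] ℝ) h h - C * ‖h‖ ^ 3 ≤ fr (x₀ + h) := by
        simp only [sub_apply, smul_apply, realInnerBilin_apply, real_inner_self_eq_norm_sq,
          smul_eq_mul]
        linarith
      have h4 : ((ENNReal.ofReal (fr (x₀ + h)) : ℝ≥0∞) : EReal) = ((fr (x₀ + h) : ℝ) : EReal) := by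
        rw [EReal.coe_ennreal_ofReal, max_eq_left (hfr0 _)]
      refine (EReal.coe_le_coe_iff.mpr h3).trans ?_
      rw [← h4]
      exact_mod_cast hfr_f (x₀ + h)
  -- the time condition
  have htime : ∀ s, 0 < s → s < t →
      ε * (d + 1) ≤ M / (2 * t * (t - s)) - d * m / (2 * t) := by
    intro s hs hst
    have hts : 0 < t - s := sub_pos.mpr hst
    have h1 := hminall x₀ (t - s) hts.le (by linarith)
    have h2 : m + s * (d * m / (2 * t) - M / (2 * t * (t - s))) ≤ v (x₀, t - s) := by
      have e1 : m + s * (d * m / (2 * t) - M / (2 * t * (t - s))) =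
          ∫ z, ρ z * (1 + s * ((d : ℝ) / (2 * t) - ‖z‖ ^ 2 / (2 * t * (t - s)))) := by
        have e : ∀ z : E, ρ z * (1 + s * ((d : ℝ) / (2 * t) - ‖z‖ ^ 2 / (2 * t * (t - s)))) =
            (1 + s * (d / (2 * t))) * ρ z - (s / (2 * t * (t - s))) * (ρ z * ‖z‖ ^ 2) := by
          intro z; ring
        simp_rw [e]
        rw [integral_sub (hρint.const_mul _), integral_const_mul, integral_const_mul, ← hm, ← hM]
        · ring
        · exact (integrable_smul_of_bounded_support hρint hρR (G := fun z : E => ‖z‖ ^ 2)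
            (by fun_prop)).const_mul _
      rw [e1]
      have e2 : v (x₀, t - s) = ∫ z, heatKernel (t - s) z * g (x₀ + z) :=
        integral_stdGaussian_add_smul hts g x₀
      rw [e2]
      refine integral_mono (integrable_smul_of_bounded_support hρint hρR
        (G := fun z : E => 1 + s * ((d : ℝ) / (2 * t) - ‖z‖ ^ 2 / (2 * t * (t - s))))
        (by fun_prop)) ?_ fun z => ?_
      · refine hgint.bdd_mul (c := heatKernel (t - s) (0 : E))
          (continuous_heatKernel _).aestronglyMeasurable (Eventually.of_forall fun z => ?_)
        rw [Real.norm_of_nonneg (heatKernel_pos _ z).le]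
        exact heatKernel_le _ hts.le z
      · have := mul_le_mul_of_nonneg_right (heatKernel_mul_le_heatKernel_sub hs.le hst z)
          (hg0 (x₀ + z))
        simp only [hρ]
        linarith
    simp only [hF, hvm] at h1
    have h3 : s * (ε * (d + 1)) ≤ s * (M / (2 * t * (t - s)) - d * m / (2 * t)) := by linarith
    exact le_of_mul_le_mul_left h3 hs
  -- As `s → 0` the quantity that `hspace` bounds above by `ε d` is bounded below by `ε (d + 1)`.
  have hlim : Tendsto (fun s => M / (2 * t * (t - s)) - d * m / (2 * t)) (𝓝[>] 0)
      (𝓝 (M / (2 * t * (t - 0)) - d * m / (2 * t))) := by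
    have : ContinuousAt (fun s => M / (2 * t * (t - s)) - d * m / (2 * t)) 0 := by
      have : 2 * t * (t - 0) ≠ 0 := by rw [sub_zero]; positivity
      fun_prop (disch := assumption)
    exact this.tendsto.mono_left nhdsWithin_le_nhds
  have hend := ge_of_tendsto hlim (by
    filter_upwards [Ioo_mem_nhdsGT ht] with s hs using htime s hs.1 hs.2)
  have e : 2 * t * (t - 0) = 2 * t ^ 2 := by ring
  rw [e] at hend
  linarith

/-- A nonnegative superharmonic function on `ℝ^d` dominates its Gaussian averages. -/
theorem SuperharmonicOn.lintegral_stdGaussian_le {f : E → ℝ≥0∞}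
    (hf : SuperharmonicOn (fun x => (f x : EReal)) Set.univ) (hfm : Measurable f) (x : E) {s : ℝ}
    (hs : 0 ≤ s) :
    ∫⁻ u, f (x + s • u) ∂(stdGaussian E) ≤ f x := by
  -- Bounded truncations supported in balls increase to `f`, so monotone convergence reduces the
  -- claim to them.
  set fn : ℕ → E → ℝ≥0∞ := fun n =>
    (Metric.closedBall (0 : E) n).indicator fun z => min (f z) n with hfn
  have hfnm : ∀ n, Measurable (fn n) := fun n =>
    (hfm.min measurable_const).indicator Metric.isClosed_closedBall.measurableSet
  have hfnle : ∀ n z, fn n z ≤ f z := fun n z =>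
    (Set.indicator_le_self _ _ z).trans (min_le_left _ _)
  have hfnn : ∀ n z, fn n z ≤ n := fun n z =>
    (Set.indicator_le_self _ _ z).trans (min_le_right _ _)
  have hmono : Monotone fn := by
    intro m n hmn z
    have hmn' : (m : ℝ) ≤ n := by exact_mod_cast hmn
    refine (Set.indicator_le_indicator_of_subset (Metric.closedBall_subset_closedBall hmn')
      (fun _ => zero_le) z).trans ?_
    refine Set.indicator_le_indicator ?_
    exact min_le_min le_rfl (by exact_mod_cast hmn)
  have hsup : ∀ z, ⨆ n, fn n z = f z := by
    intro z
    refine le_antisymm (iSup_le fun n => hfnle n z) (le_of_forall_lt fun b hb => ?_)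
    obtain ⟨n, hn⟩ := ENNReal.exists_nat_gt (hb.trans_le le_top).ne
    obtain ⟨k, hk⟩ := exists_nat_ge ‖z‖
    refine lt_of_lt_of_le ?_ (le_iSup _ (max n k))
    have hz : z ∈ Metric.closedBall (0 : E) ((max n k : ℕ) : ℝ) := by
      simp only [mem_closedBall_zero_iff]
      exact hk.trans (by exact_mod_cast le_max_right n k)
    simp only [hfn]
    rw [Set.indicator_of_mem hz]
    exact lt_min hb (hn.trans_le (by exact_mod_cast le_max_left n k))
  have h1 : ∫⁻ u, f (x + s • u) ∂(stdGaussian E) =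
      ⨆ n, ∫⁻ u, fn n (x + s • u) ∂(stdGaussian E) := by
    rw [← lintegral_iSup (f := fun n u => fn n (x + s • u))
      (fun n => (hfnm n).comp (by fun_prop)) (fun m n hmn u => hmono hmn _)]
    simp_rw [hsup]
  rw [h1]
  refine iSup_le fun n => ENNReal.le_of_forall_pos_le_add fun ε hε _ => ?_
  set μ := (stdGaussian E).map fun u => x + s • u with hμ
  have hmap : ∀ {h : E → ℝ≥0∞}, Measurable h →
      ∫⁻ z, h z ∂μ = ∫⁻ u, h (x + s • u) ∂(stdGaussian E) := fun hh =>
    lintegral_map hh (by fun_prop)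
  have : IsProbabilityMeasure μ := Measure.isProbabilityMeasure_map (by fun_prop)
  have hcoe : ∀ z, ((fn n z).toNNReal : ℝ≥0∞) = fn n z := fun z =>
    ENNReal.coe_toNNReal ((hfnn n z).trans_lt (ENNReal.natCast_lt_top n)).ne
  -- Vitali–Carathéodory approximation from below, with respect to the law of `x + s u`, supplies
  -- the upper semicontinuous minorant.
  obtain ⟨g, hgle, hgusc, hgint⟩ := exists_upperSemicontinuous_le_lintegral_le (μ := μ)
    (fun z => (fn n z).toNNReal) (by
      simp_rw [hcoe]
      exact ((lintegral_mono (hfnn n)).trans_lt (by simp)).ne) (ε := ε)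
    (by exact_mod_cast hε.ne')
  simp_rw [hcoe] at hgint
  rw [hmap (hfnm n)] at hgint
  refine hgint.trans ?_
  gcongr
  have hgf : ∀ z, (g z : ℝ≥0∞) ≤ fn n z := fun z => by
    rw [← hcoe z]; exact_mod_cast hgle z
  have hgn : ∀ z, (g z : ℝ) ≤ n := fun z => by
    have := (hgf z).trans (hfnn n z)
    exact_mod_cast this
  have hgm : Measurable g := hgusc.measurable
  have key := hf.integral_stdGaussian_le (g := fun z => (g z : ℝ)) (N := n) (R := n) ?_
    (fun z => (g z).coe_nonneg) hgn ?_ ?_ x (sq_nonneg s)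
  · rw [Real.sqrt_sq hs, ofReal_integral_eq_lintegral_ofReal] at key
    · rw [hmap (by fun_prop)]
      simpa using key
    · exact Integrable.of_bound
        (hgm.coe_nnreal_real.comp (by fun_prop)).aestronglyMeasurable n (Eventually.of_forall fun u => by simpa using hgn _)
    · exact Eventually.of_forall fun u => (g _).coe_nonneg
  · exact NNReal.continuous_coe.comp_upperSemicontinuous hgusc (fun a b h => by exact_mod_cast h)
  · intro z hz
    have : fn n z = 0 := Set.indicator_of_notMem (by simpa using hz) _
    have h2 := hgf z
    rw [this] at h2
    simpa using h2
  · intro z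
    simpa using (hgf z).trans (hfnle n z)

end HeatComparison

/-! ### Jensen's inequality for the extended logarithm -/

section Jensen

/-- The positive part of the extended logarithm. -/
noncomputable def logPos (x : ℝ≥0∞) : ℝ≥0∞ := (ENNReal.log x).toENNReal

/-- The negative part of the extended logarithm. -/
noncomputable def logNeg (x : ℝ≥0∞) : ℝ≥0∞ := (-ENNReal.log x).toENNReal

lemma measurable_logPos : Measurable logPos := by unfold logPos; fun_prop

lemma measurable_logNeg : Measurable logNeg := by unfold logNeg; fun_prop

lemma logPos_zero : logPos 0 = 0 := by simp [logPos]

lemma logPos_top : logPos ⊤ = ⊤ := by simp [logPos]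

lemma logNeg_zero : logNeg 0 = ⊤ := by simp [logNeg]

lemma logPos_ofReal {a : ℝ} (ha : 0 < a) :
    logPos (ENNReal.ofReal a) = ENNReal.ofReal (max (Real.log a) 0) := by
  rw [logPos, ENNReal.log_ofReal_of_pos ha, EReal.real_coe_toENNReal]
  simp [ENNReal.ofReal_max]

lemma logNeg_ofReal {a : ℝ} (ha : 0 < a) :
    logNeg (ENNReal.ofReal a) = ENNReal.ofReal (max (-Real.log a) 0) := by
  rw [logNeg, ENNReal.log_ofReal_of_pos ha, ← EReal.coe_neg, EReal.real_coe_toENNReal]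
  simp [ENNReal.ofReal_max]

lemma logNeg_antitone : Antitone logNeg := fun _ _ h =>
  EReal.toENNReal_le_toENNReal (EReal.neg_le_neg_iff.mpr (ENNReal.log_le_log h))

lemma logPos_eq_zero_or_logNeg_eq_zero (x : ℝ≥0∞) : logPos x = 0 ∨ logNeg x = 0 := by
  rcases le_total (ENNReal.log x) 0 with h | h
  · exact Or.inl (EReal.toENNReal_of_nonpos h)
  · exact Or.inr (EReal.toENNReal_of_nonpos (by simpa using h))

lemma logPos_le_self (x : ℝ≥0∞) : logPos x ≤ x := by
  rcases eq_or_ne x ⊤ with rfl | hx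
  · exact le_top
  rcases eq_or_ne x 0 with rfl | hx0
  · simp [logPos_zero]
  obtain ⟨a, ha, rfl⟩ : ∃ a : ℝ, 0 < a ∧ x = ENNReal.ofReal a :=
    ⟨x.toReal, ENNReal.toReal_pos hx0 hx, (ENNReal.ofReal_toReal hx).symm⟩
  rw [logPos_ofReal ha]
  refine ENNReal.ofReal_le_ofReal (max_le ?_ ha.le)
  linarith [Real.log_le_sub_one_of_pos ha]

/-- The tangent line inequality for the logarithm, without subtractions. -/
lemma logPos_add_logNeg_add_one_le (x : ℝ≥0∞) {b : ℝ} (hb : 0 < b) :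
    logPos x + logNeg (ENNReal.ofReal b) + 1 ≤
      logPos (ENNReal.ofReal b) + logNeg x + x / ENNReal.ofReal b := by
  have hb' : ENNReal.ofReal b ≠ 0 := by simpa using hb
  rcases eq_or_ne x ⊤ with rfl | hx
  · rw [ENNReal.top_div_of_ne_top ENNReal.ofReal_ne_top]; simp
  rcases eq_or_ne x 0 with rfl | hx0
  · simp [logNeg_zero]
  obtain ⟨a, ha, rfl⟩ : ∃ a : ℝ, 0 < a ∧ x = ENNReal.ofReal a :=
    ⟨x.toReal, ENNReal.toReal_pos hx0 hx, (ENNReal.ofReal_toReal hx).symm⟩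
  rw [logPos_ofReal ha, logPos_ofReal hb, logNeg_ofReal ha, logNeg_ofReal hb,
    ← ENNReal.ofReal_div_of_pos hb, ← ENNReal.ofReal_one, ← ENNReal.ofReal_add (by positivity)
    (by positivity), ← ENNReal.ofReal_add (by positivity) (by positivity),
    ← ENNReal.ofReal_add (by positivity) (by positivity),
    ← ENNReal.ofReal_add (by positivity) (by positivity)]
  refine ENNReal.ofReal_le_ofReal ?_
  have h1 := Real.log_le_sub_one_of_pos (div_pos ha hb)
  rw [Real.log_div ha.ne' hb.ne'] at h1
  have h2 := max_zero_sub_max_neg_zero_eq_self (Real.log a)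
  have h3 := max_zero_sub_max_neg_zero_eq_self (Real.log b)
  linarith

/-- Strictness of `log y < y - 1` for `y ≠ 1`. The value `x = ⊤` must be excluded because both sides
are then infinite. -/
lemma eq_of_logPos_add_logNeg_add_one_eq {x : ℝ≥0∞} (hx : x ≠ ⊤) {b : ℝ} (hb : 0 < b)
    (h : logPos x + logNeg (ENNReal.ofReal b) + 1 =
      logPos (ENNReal.ofReal b) + logNeg x + x / ENNReal.ofReal b) : x = ENNReal.ofReal b := by
  rcases eq_or_ne x 0 with rfl | hx0
  · simp [logNeg_zero, logPos_zero, logNeg_ofReal hb] at h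
  obtain ⟨a, ha, rfl⟩ : ∃ a : ℝ, 0 < a ∧ x = ENNReal.ofReal a :=
    ⟨x.toReal, ENNReal.toReal_pos hx0 hx, (ENNReal.ofReal_toReal hx).symm⟩
  rw [logPos_ofReal ha, logPos_ofReal hb, logNeg_ofReal ha, logNeg_ofReal hb,
    ← ENNReal.ofReal_div_of_pos hb, ← ENNReal.ofReal_one, ← ENNReal.ofReal_add (by positivity)
    (by positivity), ← ENNReal.ofReal_add (by positivity) (by positivity),
    ← ENNReal.ofReal_add (by positivity) (by positivity),
    ← ENNReal.ofReal_add (by positivity) (by positivity),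
    ENNReal.ofReal_eq_ofReal_iff (by positivity) (by positivity)] at h
  have h2 := max_zero_sub_max_neg_zero_eq_self (Real.log a)
  have h3 := max_zero_sub_max_neg_zero_eq_self (Real.log b)
  by_contra hne
  have hab : a / b ≠ 1 := fun h4 => hne (by rw [(div_eq_one_iff_eq hb.ne').mp h4])
  have h1 := Real.log_lt_sub_one_of_pos (div_pos ha hb) hab
  rw [Real.log_div ha.ne' hb.ne'] at h1
  linarith

variable {Ω : Type*} [MeasurableSpace Ω] {P : Measure Ω} [IsProbabilityMeasure P]

lemma lintegral_tangent_eq {X : Ω → ℝ≥0∞} (hX : Measurable X) (b : ℝ) :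
    ∫⁻ ω, (logPos (ENNReal.ofReal b) + logNeg (X ω) + X ω / ENNReal.ofReal b) ∂P =
      logPos (ENNReal.ofReal b) + ∫⁻ ω, logNeg (X ω) ∂P +
        (∫⁻ ω, X ω ∂P) / ENNReal.ofReal b := by
  have h1 : Measurable fun ω => logNeg (X ω) := measurable_logNeg.comp hX
  rw [lintegral_add_left (by fun_prop), lintegral_add_left (by fun_prop)]
  simp [div_eq_mul_inv, lintegral_mul_const _ hX]

lemma lintegral_logPos_add_eq {X : Ω → ℝ≥0∞} (hX : Measurable X) (c : ℝ≥0∞) :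
    ∫⁻ ω, (logPos (X ω) + c + 1) ∂P = ∫⁻ ω, logPos (X ω) ∂P + c + 1 := by
  have h1 : Measurable fun ω => logPos (X ω) := measurable_logPos.comp hX
  rw [lintegral_add_left (by fun_prop), lintegral_add_left h1]
  simp

/-- **Jensen's inequality** for the extended logarithm, without subtractions. -/
lemma lintegral_logPos_add_logNeg_le {X : Ω → ℝ≥0∞} (hX : Measurable X) {c : ℝ≥0∞}
    (hc : ∫⁻ ω, X ω ∂P ≤ c) :
    ∫⁻ ω, logPos (X ω) ∂P + logNeg c ≤ logPos c + ∫⁻ ω, logNeg (X ω) ∂P := by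
  rcases eq_or_ne c ⊤ with rfl | hct
  · simp [logPos_top]
  rcases eq_or_ne c 0 with rfl | hc0
  · have h0 : X =ᵐ[P] 0 := (lintegral_eq_zero_iff hX).mp (le_antisymm hc zero_le)
    have h1 : ∫⁻ ω, logNeg (X ω) ∂P = ⊤ := by
      rw [lintegral_congr_ae (g := fun _ => ⊤) (h0.mono fun ω hω => by simp [hω, logNeg_zero])]
      simp
    simp [h1]
  obtain ⟨b, hb, rfl⟩ : ∃ b : ℝ, 0 < b ∧ c = ENNReal.ofReal b :=
    ⟨c.toReal, ENNReal.toReal_pos hc0 hct, (ENNReal.ofReal_toReal hct).symm⟩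
  have h1 := lintegral_mono (μ := P) fun ω => logPos_add_logNeg_add_one_le (X ω) hb
  rw [lintegral_tangent_eq hX, lintegral_logPos_add_eq hX] at h1
  -- The tangent is taken at `c`, so the linear term integrates to at most `1` and cancels the
  -- constant of the tangent inequality.
  have h2 : (∫⁻ ω, X ω ∂P) / ENNReal.ofReal b ≤ 1 := ENNReal.div_le_of_le_mul (by simpa using hc)
  exact (ENNReal.add_le_add_iff_right ENNReal.one_ne_top).mp
    (h1.trans (add_le_add le_rfl h2))

/-- One of `logPos c`, `logNeg c` vanishes: either Jensen's inequality loses its positive term on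
the right, or there is nothing to prove. -/
lemma logNeg_le_lintegral_logNeg {X : Ω → ℝ≥0∞} (hX : Measurable X) {c : ℝ≥0∞}
    (hc : ∫⁻ ω, X ω ∂P ≤ c) : logNeg c ≤ ∫⁻ ω, logNeg (X ω) ∂P := by
  rcases logPos_eq_zero_or_logNeg_eq_zero c with h | h
  · have := lintegral_logPos_add_logNeg_le hX hc
    rw [h, zero_add] at this
    exact le_add_self.trans this
  · simp [h]

/-- The equality case of Jensen's inequality for the extended logarithm. -/
lemma ae_eq_of_lintegral_logPos_add_logNeg_eq {X : Ω → ℝ≥0∞} (hX : Measurable X) {c : ℝ≥0∞}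
    (hc : ∫⁻ ω, X ω ∂P ≤ c) (hc0 : c ≠ 0) (hct : c ≠ ⊤) (hfin : ∫⁻ ω, logNeg (X ω) ∂P ≠ ⊤)
    (h : ∫⁻ ω, logPos (X ω) ∂P + logNeg c = logPos c + ∫⁻ ω, logNeg (X ω) ∂P) :
    ∀ᵐ ω ∂P, X ω = c := by
  obtain ⟨b, hb, rfl⟩ : ∃ b : ℝ, 0 < b ∧ c = ENNReal.ofReal b :=
    ⟨c.toReal, ENNReal.toReal_pos hc0 hct, (ENNReal.ofReal_toReal hct).symm⟩
  have h2 : (∫⁻ ω, X ω ∂P) / ENNReal.ofReal b ≤ 1 := ENNReal.div_le_of_le_mul (by simpa using hc)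
  have hle : ∫⁻ ω, (logPos (ENNReal.ofReal b) + logNeg (X ω) + X ω / ENNReal.ofReal b) ∂P ≤
      ∫⁻ ω, (logPos (X ω) + logNeg (ENNReal.ofReal b) + 1) ∂P := by
    rw [lintegral_tangent_eq hX, lintegral_logPos_add_eq hX, h]
    exact add_le_add le_rfl h2
  have hpos : Measurable fun ω => logPos (X ω) := measurable_logPos.comp hX
  have hneg : Measurable fun ω => logNeg (X ω) := measurable_logNeg.comp hX
  have hlhs : ∫⁻ ω, (logPos (X ω) + logNeg (ENNReal.ofReal b) + 1) ∂P ≠ ⊤ := by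
    rw [lintegral_logPos_add_eq hX, h, logPos_ofReal hb]
    simp [hfin]
  -- Equality of the finite integrals turns the pointwise tangent inequality into an almost sure
  -- equality.
  have key := ae_eq_of_ae_le_of_lintegral_le (μ := P)
    (Filter.Eventually.of_forall fun ω => logPos_add_logNeg_add_one_le (X ω) hb) hlhs
    (by fun_prop) hle
  have hXtop : ∀ᵐ ω ∂P, X ω < ⊤ := ae_lt_top hX (hc.trans_lt ENNReal.ofReal_lt_top).ne
  filter_upwards [key, hXtop] with ω hω hωt
  exact eq_of_logPos_add_logNeg_add_one_eq hωt.ne hb hω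

end Jensen

/-! ### Uniqueness for Laplace transforms -/

section LaplaceTransform

open ProbabilityTheory

/-- Finite measures with the same finite Laplace transform are equal. -/
lemma Measure.ext_of_lintegral_exp_inner_eq {F : Type*} [NormedAddCommGroup F]
    [InnerProductSpace ℝ F] [CompleteSpace F] [MeasurableSpace F] [BorelSpace F]
    [SecondCountableTopology F]
    {μ ν : Measure F} [IsFiniteMeasure μ] [IsFiniteMeasure ν]
    (hfin : ∀ t : F, ∫⁻ y, ENNReal.ofReal (Real.exp (inner ℝ y t)) ∂μ ≠ ⊤)
    (h : ∀ t : F, ∫⁻ y, ENNReal.ofReal (Real.exp (inner ℝ y t)) ∂μ =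
      ∫⁻ y, ENNReal.ofReal (Real.exp (inner ℝ y t)) ∂ν) : μ = ν := by
  apply Measure.ext_of_charFun
  ext t
  have hmgf : mgf (fun y => inner ℝ y t) μ = mgf (fun y => inner ℝ y t) ν := by
    ext s
    simp only [mgf]
    rw [integral_eq_lintegral_of_nonneg_ae (Filter.Eventually.of_forall fun y => (Real.exp_pos _).le)
      (by fun_prop), integral_eq_lintegral_of_nonneg_ae
      (Filter.Eventually.of_forall fun y => (Real.exp_pos _).le) (by fun_prop)]
    have := h (s • t)
    simp only [real_inner_smul_right] at this
    rw [this]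
  have hset : integrableExpSet (fun y => inner ℝ y t) μ = Set.univ := by
    refine Set.eq_univ_of_forall fun s => ?_
    refine ⟨by fun_prop, ?_⟩
    rw [hasFiniteIntegral_iff_ofReal (Filter.Eventually.of_forall fun y => (Real.exp_pos _).le)]
    have := hfin (s • t)
    simp only [real_inner_smul_right] at this
    exact this.lt_top
  have hzero : μ = 0 ↔ ν = 0 := by
    have h0 := h 0
    simp only [inner_zero_right, Real.exp_zero, ENNReal.ofReal_one, lintegral_const, one_mul] at h0
    rw [← Measure.measure_univ_eq_zero, h0, Measure.measure_univ_eq_zero]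
  -- The moment generating functions of each projection are finite everywhere, hence extend
  -- analytically; agreement at `I` is agreement of characteristic functions.
  have key := eqOn_complexMGF_of_mgf' hmgf hzero (x := Complex.I) (by simp [hset])
  simp only [complexMGF] at key
  rw [charFun_apply, charFun_apply]
  simpa [mul_comm] using key

end LaplaceTransform

/-! ### The matrix `A*`, Gaussian domination, and recovery of the prior from its marginals -/

section Covariance

open ProbabilityTheory

variable {d : ℕ}

local notation "E" => EuclideanSpace ℝ (Fin d)

/-- `A*` is a square root of `S₂ - S₁`. -/
lemma starMatrix_mul_transpose {S₁ S₂ U : Matrix (Fin d) (Fin d) ℝ} {l : Fin d → ℝ}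
    (hS₁ : S₁.PosDef) (hS₂ : S₂.PosDef) (hle : (S₂ - S₁).PosSemidef)
    (hU : U ∈ Matrix.orthogonalGroup (Fin d) ℝ)
    (hdiag : CFC.sqrt S₁ * S₂⁻¹ * CFC.sqrt S₁ = Uᵀ * Matrix.diagonal l * U) :
    starMatrix S₁ U l * (starMatrix S₁ U l)ᵀ = S₂ - S₁ := by
  have hUU : U * Uᵀ = 1 := by
    simpa [Matrix.star_eq_conjTranspose, Matrix.conjTranspose_eq_transpose_of_trivial] using
      (Matrix.mem_orthogonalGroup_iff (Fin d) ℝ).mp hU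
  have hUU' : Uᵀ * U = 1 := by
    simpa [Matrix.star_eq_conjTranspose, Matrix.conjTranspose_eq_transpose_of_trivial] using
      (Matrix.mem_orthogonalGroup_iff' (Fin d) ℝ).mp hU
  set Q := CFC.sqrt S₁ with hQ
  have hQQ : Q * Q = S₁ := CFC.sqrt_mul_sqrt_self _ hS₁.posSemidef.nonneg
  have hQdet : IsUnit Q.det := by
    rw [hQ, det_sqrt hS₁]
    exact (Real.sqrt_pos.mpr hS₁.det_pos).ne'.isUnit
  have hS₂det : IsUnit S₂.det := hS₂.det_pos.ne'.isUnit
  have hQt : Qᵀ = Q := isSymm_sqrt S₁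
  have hQinv : Q * Q⁻¹ = 1 := Matrix.mul_nonsing_inv _ hQdet
  have hQinv' : Q⁻¹ * Q = 1 := Matrix.nonsing_inv_mul _ hQdet
  have hdiag' : Matrix.diagonal l = U * (Q * S₂⁻¹ * Q) * Uᵀ := by
    rw [hdiag]
    calc Matrix.diagonal l = (U * Uᵀ) * Matrix.diagonal l * (U * Uᵀ) := by rw [hUU]; simp
      _ = _ := by simp only [mul_assoc]
  have hinv : (Matrix.diagonal l)⁻¹ = U * (Q⁻¹ * S₂ * Q⁻¹) * Uᵀ := by
    apply Matrix.inv_eq_right_inv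
    rw [hdiag']
    calc U * (Q * S₂⁻¹ * Q) * Uᵀ * (U * (Q⁻¹ * S₂ * Q⁻¹) * Uᵀ)
        = U * Q * S₂⁻¹ * Q * (Uᵀ * U) * Q⁻¹ * S₂ * Q⁻¹ * Uᵀ := by simp only [mul_assoc]
      _ = U * Q * S₂⁻¹ * (Q * Q⁻¹) * S₂ * Q⁻¹ * Uᵀ := by rw [hUU', mul_one]; simp only [mul_assoc]
      _ = U * Q * (S₂⁻¹ * S₂) * Q⁻¹ * Uᵀ := by rw [hQinv, mul_one]; simp only [mul_assoc]
      _ = U * (Q * Q⁻¹) * Uᵀ := by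
        rw [Matrix.nonsing_inv_mul _ hS₂det, mul_one]; simp only [mul_assoc]
      _ = 1 := by rw [hQinv, mul_one, hUU]
  have hsub : (Matrix.diagonal l)⁻¹ - 1 = (U * Q⁻¹) * (S₂ - S₁) * (U * Q⁻¹)ᵀ := by
    have h1 : (U * Q⁻¹)ᵀ = Q⁻¹ * Uᵀ := by
      rw [Matrix.transpose_mul, Matrix.transpose_nonsing_inv, hQt]
    rw [h1, hinv, mul_sub, sub_mul, ← hQQ]
    have h2 : U * Q⁻¹ * (Q * Q) * (Q⁻¹ * Uᵀ) = 1 := by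
      calc U * Q⁻¹ * (Q * Q) * (Q⁻¹ * Uᵀ) = U * (Q⁻¹ * Q) * (Q * Q⁻¹) * Uᵀ := by
            simp only [mul_assoc]
        _ = 1 := by rw [hQinv, hQinv', mul_one, mul_one, hUU]
    rw [h2]
    simp only [mul_assoc]
  -- Congruence with `S₂ - S₁` gives positivity, without which `CFC.sqrt` need not square back to
  -- its argument.
  have hpsd : ((Matrix.diagonal l)⁻¹ - 1).PosSemidef := by
    rw [hsub, ← Matrix.conjTranspose_eq_transpose_of_trivial]
    exact hle.mul_mul_conjTranspose_same _
  unfold starMatrix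
  rw [← hQ]
  set W := CFC.sqrt ((Matrix.diagonal l)⁻¹ - 1) with hW
  have hWW : W * W = (Matrix.diagonal l)⁻¹ - 1 := CFC.sqrt_mul_sqrt_self _ hpsd.nonneg
  have hWt : Wᵀ = W := isSymm_sqrt _
  rw [Matrix.transpose_mul, Matrix.transpose_mul, Matrix.transpose_transpose, hWt, hQt]
  calc Q * Uᵀ * W * (W * (U * Q)) = Q * Uᵀ * (W * W) * (U * Q) := by simp only [mul_assoc]
    _ = Q * Uᵀ * (U * (Q⁻¹ * S₂ * Q⁻¹) * Uᵀ) * (U * Q) - Q * (Uᵀ * U) * Q := by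
      rw [hWW, hinv, mul_sub, sub_mul, mul_one]; simp only [mul_assoc]
    _ = Q * (Uᵀ * U) * (Q⁻¹ * S₂ * Q⁻¹) * (Uᵀ * U) * Q - Q * (Uᵀ * U) * Q := by
      simp only [mul_assoc]
    _ = (Q * Q⁻¹) * S₂ * (Q⁻¹ * Q) - Q * Q := by
      rw [hUU', mul_one, mul_one]; simp only [mul_assoc]
    _ = S₂ - S₁ := by rw [hQinv, hQinv', one_mul, mul_one, hQQ]

/-- The quadratic form of the inverse covariance matrix is comparable to the squared norm. -/
lemma Matrix.PosDef.exists_inv_quadratic_bounds {S : Matrix (Fin d) (Fin d) ℝ} (hS : S.PosDef) :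
    ∃ a b : ℝ, 0 < a ∧ 0 < b ∧ ∀ v : E, a * ‖v‖ ^ 2 ≤ v.ofLp ⬝ᵥ (S⁻¹ *ᵥ v.ofLp) ∧
      v.ofLp ⬝ᵥ (S⁻¹ *ᵥ v.ofLp) ≤ b * ‖v‖ ^ 2 := by
  set Q := CFC.sqrt S with hQ
  have hQQ : Q * Q = S := CFC.sqrt_mul_sqrt_self _ hS.posSemidef.nonneg
  have hSdet : IsUnit S.det := hS.det_pos.ne'.isUnit
  have hQt : Qᵀ = Q := isSymm_sqrt S
  set L := Matrix.toEuclideanCLM (𝕜 := ℝ) Q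
  set L' := Matrix.toEuclideanCLM (𝕜 := ℝ) (Q * S⁻¹)
  -- With `L'` given by `Q S⁻¹`, and `L` inverting it, both bounds are operator norm estimates.
  have hq : ∀ v : E, v.ofLp ⬝ᵥ (S⁻¹ *ᵥ v.ofLp) = ‖L' v‖ ^ 2 := by
    intro v
    have h1 : ‖L' v‖ ^ 2 = ((Q * S⁻¹) *ᵥ v.ofLp) ⬝ᵥ ((Q * S⁻¹) *ᵥ v.ofLp) := by
      rw [EuclideanSpace.real_norm_sq_eq]
      simp [L', dotProduct, sq]
    have h2 : (Q * S⁻¹)ᵀ * (Q * S⁻¹) = S⁻¹ := by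
      rw [Matrix.transpose_mul, hQt, Matrix.transpose_nonsing_inv]
      have : Sᵀ = S := by
        simpa [Matrix.conjTranspose_eq_transpose_of_trivial] using hS.isHermitian.eq
      rw [this]
      calc S⁻¹ * Q * (Q * S⁻¹) = S⁻¹ * (Q * Q) * S⁻¹ := by simp only [mul_assoc]
        _ = S⁻¹ := by rw [hQQ, Matrix.nonsing_inv_mul _ hSdet, one_mul]
    conv_rhs => rw [h1, Matrix.dotProduct_mulVec, ← Matrix.mulVec_transpose, Matrix.mulVec_mulVec,
      h2, dotProduct_comm]
  have hLL : ∀ v : E, L (L' v) = v := by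
    intro v
    rw [← ContinuousLinearMap.comp_apply, ← ContinuousLinearMap.mul_def, ← map_mul, ← mul_assoc,
      hQQ, Matrix.mul_nonsing_inv _ hSdet, map_one]
    rfl
  refine ⟨1 / (‖L‖ ^ 2 + 1), ‖L'‖ ^ 2 + 1, by positivity, by positivity, fun v => ?_⟩
  rw [hq]
  constructor
  · rw [div_mul_eq_mul_div, one_mul, div_le_iff₀ (by positivity)]
    have h1 : ‖v‖ ≤ ‖L‖ * ‖L' v‖ := by
      conv_lhs => rw [← hLL v]
      exact L.le_opNorm _
    calc ‖v‖ ^ 2 ≤ (‖L‖ * ‖L' v‖) ^ 2 := by gcongr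
      _ = ‖L' v‖ ^ 2 * ‖L‖ ^ 2 := by ring
      _ ≤ _ := by gcongr; linarith
  · calc ‖L' v‖ ^ 2 ≤ (‖L'‖ * ‖v‖) ^ 2 := by gcongr; exact L'.le_opNorm v
      _ = ‖L'‖ ^ 2 * ‖v‖ ^ 2 := by ring
      _ ≤ _ := by gcongr; linarith

/-- Every normal density is dominated by a multiple of a sufficiently spread out normal density
with any other mean and shape. -/
lemma exists_normalDensity_le {S T : Matrix (Fin d) (Fin d) ℝ} (hS : S.PosDef) (hT : T.PosDef)
    (z x : E) : ∃ s C : ℝ, 0 < s ∧ 0 ≤ C ∧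
      ∀ y : E, normalDensity y z S ≤ C * normalDensity y x (s ^ 2 • T) := by
  obtain ⟨a, _, ha, _, hab⟩ := hS.exists_inv_quadratic_bounds
  obtain ⟨_, b, _, hb, hab'⟩ := hT.exists_inv_quadratic_bounds
  -- Chosen so that `s⁻² b · 2 = a`, where the factor `2` comes from splitting `‖y - x‖²` at `z`.
  set s := Real.sqrt (2 * b / a) with hs
  have hs2 : s ^ 2 = 2 * b / a := Real.sq_sqrt (by positivity)
  have hs0 : 0 < s := Real.sqrt_pos.mpr (by positivity)
  have hsT : (s ^ 2 • T).PosDef := hT.smul (by positivity)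
  set k₁ := 1 / ((2 * Real.pi) ^ ((d : ℝ) / 2) * Real.sqrt S.det) with hk₁
  set k₂ := 1 / ((2 * Real.pi) ^ ((d : ℝ) / 2) * Real.sqrt (s ^ 2 • T).det) with hk₂
  have hk₁0 : 0 < k₁ := by have := hS.det_pos; positivity
  have hk₂0 : 0 < k₂ := by have := hsT.det_pos; positivity
  refine ⟨s, k₁ / k₂ * Real.exp (a * ‖x - z‖ ^ 2 / 2), hs0, by positivity, fun y => ?_⟩
  unfold normalDensity
  rw [← hk₁, ← hk₂]
  have hinv : (s ^ 2 • T)⁻¹ = (s ^ 2)⁻¹ • T⁻¹ := by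
    have : Invertible (s ^ 2) := invertibleOfNonzero (by positivity)
    rw [Matrix.inv_smul _ _ hT.det_pos.ne'.isUnit, invOf_eq_inv]
  rw [hinv, Matrix.smul_mulVec, dotProduct_smul, smul_eq_mul]
  have h1 := (hab (y - z)).1
  have h2 := (hab' (y - x)).2
  set q₁ := (y - z).ofLp ⬝ᵥ (S⁻¹ *ᵥ (y - z).ofLp)
  set q₂ := (y - x).ofLp ⬝ᵥ (T⁻¹ *ᵥ (y - x).ofLp)
  have h3 : ‖y - x‖ ^ 2 ≤ 2 * (‖y - z‖ ^ 2 + ‖x - z‖ ^ 2) := by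
    have h4 : ‖y - x‖ ≤ ‖y - z‖ + ‖x - z‖ := by
      rw [norm_sub_rev x z]; exact norm_sub_le_norm_sub_add_norm_sub _ _ _
    have h5 : ‖y - x‖ ^ 2 ≤ (‖y - z‖ + ‖x - z‖) ^ 2 := by gcongr
    nlinarith [sq_nonneg (‖y - z‖ - ‖x - z‖)]
  have h6 : (s ^ 2)⁻¹ * q₂ ≤ a * (‖y - z‖ ^ 2 + ‖x - z‖ ^ 2) := by
    calc (s ^ 2)⁻¹ * q₂ ≤ (s ^ 2)⁻¹ * (b * (2 * (‖y - z‖ ^ 2 + ‖x - z‖ ^ 2))) := by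
          gcongr
          exact h2.trans (by gcongr)
      _ = _ := by rw [hs2]; field_simp
  have h7 : k₁ / k₂ * Real.exp (a * ‖x - z‖ ^ 2 / 2) * (k₂ * Real.exp (-((s ^ 2)⁻¹ * q₂) / 2)) =
      k₁ * Real.exp (a * ‖x - z‖ ^ 2 / 2 + -((s ^ 2)⁻¹ * q₂) / 2) := by
    rw [Real.exp_add]; field_simp
  rw [h7]
  gcongr
  linarith

lemma multivariateGaussian_zero_right (x : E) :
    multivariateGaussian x (0 : Matrix (Fin d) (Fin d) ℝ) = Measure.dirac x := by
  simp [multivariateGaussian]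

/-- The law of `x + s A u` for a standard normal vector `u`. -/
lemma lintegral_stdGaussian_comp_add_smul {D A : Matrix (Fin d) (Fin d) ℝ}
    (hA : A * Aᵀ = D) (x : E) (s : ℝ) {h : E → ℝ≥0∞} (hh : Measurable h) :
    ∫⁻ u, h (x + Matrix.toEuclideanLin A (s • u)) ∂(stdGaussian E) =
      ∫⁻ z, h z ∂(multivariateGaussian x (s ^ 2 • D)) := by
  have h1 : (s • A) * (s • A)ᵀ = s ^ 2 • D := by
    rw [Matrix.transpose_smul, Matrix.smul_mul, Matrix.mul_smul, smul_smul, hA, sq]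
  rw [← zero_add (s ^ 2 • D), lintegral_multivariateGaussian_add Matrix.PosSemidef.zero h1 x hh,
    multivariateGaussian_zero_right, lintegral_dirac]
  refine lintegral_congr fun u => ?_
  rw [map_smul, map_smul]
  rfl

/-- Integrability is known only for Gaussians of shape `D` about one point `x`, but at all scales; a
wide one dominates any given normal density. -/
lemma marginal_lt_top {D A S : Matrix (Fin d) (Fin d) ℝ} (hA : A * Aᵀ = D) (hD : D.PosDef)
    (hS : S.PosDef) {π : E → ℝ≥0∞} (hπ : Measurable π) {x : E}
    (hx : ∀ s : ℝ, 0 ≤ s →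
      ∫⁻ u, π (x + Matrix.toEuclideanLin A (s • u)) ∂(stdGaussian E) < ⊤) (z : E) :
    marginal π z S < ⊤ := by
  obtain ⟨s, C, hs, hC, hle⟩ := exists_normalDensity_le hS hD z x
  have h1 := hx s hs.le
  rw [lintegral_stdGaussian_comp_add_smul hA x s hπ,
    lintegral_multivariateGaussian (hD.smul (by positivity)) x hπ] at h1
  rw [marginal_eq_lintegral hS hπ, lintegral_multivariateGaussian hS z hπ]
  calc ∫⁻ y, ENNReal.ofReal (normalDensity y z S) * π y
      ≤ ∫⁻ y, ENNReal.ofReal C * (ENNReal.ofReal (normalDensity y x (s ^ 2 • D)) * π y) := by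
        refine lintegral_mono fun y => ?_
        rw [← mul_assoc, ← ENNReal.ofReal_mul hC]
        gcongr
        exact hle y
    _ = ENNReal.ofReal C * ∫⁻ y, ENNReal.ofReal (normalDensity y x (s ^ 2 • D)) * π y :=
        lintegral_const_mul' _ _ ENNReal.ofReal_ne_top
    _ < ⊤ := ENNReal.mul_lt_top ENNReal.ofReal_lt_top h1

/-- A prior that is bounded below by a positive constant on a ball has a marginal whose logarithm
has an integrable negative part. -/
lemma lintegral_logNeg_marginal_lt_top {S : Matrix (Fin d) (Fin d) ℝ} (hS : S.PosDef)
    {π : E → ℝ≥0∞} {y₀ : E} {r c : ℝ} (hr : 0 < r) (hc : 0 < c)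
    (hπc : ∀ y ∈ Metric.ball y₀ r, ENNReal.ofReal c ≤ π y) (μ : E) :
    ∫⁻ z, logNeg (marginal π z S) ∂(multivariateGaussian μ S) < ⊤ := by
  obtain ⟨_, b, _, hb, hab⟩ := hS.exists_inv_quadratic_bounds
  set k := 1 / ((2 * Real.pi) ^ ((d : ℝ) / 2) * Real.sqrt S.det) with hk
  have hk0 : 0 < k := by have := hS.det_pos; positivity
  set V := (volume (Metric.ball y₀ r)).toReal with hV
  have hVtop : volume (Metric.ball y₀ r) ≠ ⊤ := measure_ball_lt_top.ne
  have hV0 : 0 < V := ENNReal.toReal_pos (Metric.measure_ball_pos volume y₀ hr).ne' hVtop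
  set K := k * c * V with hK
  have hK0 : 0 < K := by positivity
  set e : E → ℝ := fun z => b * (2 * ‖z‖ ^ 2 + 2 * (‖y₀‖ + r) ^ 2) / 2 with he
  -- The ball alone contributes a Gaussian lower bound, so the negative part of the logarithm grows
  -- at most quadratically.
  have hlow : ∀ z, ENNReal.ofReal (K * Real.exp (-e z)) ≤ marginal π z S := by
    intro z
    have h1 : ∀ y ∈ Metric.ball y₀ r, k * Real.exp (-e z) ≤ normalDensity z y S := by
      intro y hy
      unfold normalDensity
      rw [← hk]
      gcongr
      have h2 := (hab (z - y)).2
      have h3 : ‖z - y‖ ≤ ‖z‖ + (‖y₀‖ + r) := by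
        have h4 : ‖y‖ ≤ ‖y₀‖ + r := by
          have h5 : ‖y - y₀‖ < r := by simpa [dist_eq_norm] using hy
          have h6 : ‖y‖ ≤ ‖y - y₀‖ + ‖y₀‖ := by
            simpa using norm_add_le (y - y₀) y₀
          linarith
        exact (norm_sub_le _ _).trans (by linarith)
      have h7 : ‖z - y‖ ^ 2 ≤ 2 * ‖z‖ ^ 2 + 2 * (‖y₀‖ + r) ^ 2 := by
        have h8 : ‖z - y‖ ^ 2 ≤ (‖z‖ + (‖y₀‖ + r)) ^ 2 := by gcongr
        nlinarith [sq_nonneg (‖z‖ - (‖y₀‖ + r))]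
      have h9 := h2.trans (mul_le_mul_of_nonneg_left h7 hb.le)
      simp only [he]
      linarith
    calc ENNReal.ofReal (K * Real.exp (-e z))
        = ENNReal.ofReal (k * Real.exp (-e z)) * ENNReal.ofReal c * volume (Metric.ball y₀ r) := by
          rw [← ENNReal.ofReal_toReal hVtop, ← ENNReal.ofReal_mul (by positivity),
            ← ENNReal.ofReal_mul (by positivity)]
          congr 1
          rw [hK]; ring
      _ = ∫⁻ _ in Metric.ball y₀ r, ENNReal.ofReal (k * Real.exp (-e z)) * ENNReal.ofReal c := by
          rw [setLIntegral_const]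
      _ ≤ ∫⁻ y in Metric.ball y₀ r, ENNReal.ofReal (normalDensity z y S) * π y := by
          refine setLIntegral_mono' measurableSet_ball fun y hy => ?_
          gcongr
          · exact h1 y hy
          · exact hπc y hy
      _ ≤ marginal π z S := setLIntegral_le_lintegral _ _
  have hint : Integrable (fun z : E => |Real.log K| + e z) (multivariateGaussian μ S) := by
    have h1 : Integrable (fun z : E => ‖z‖ ^ 2) (multivariateGaussian μ S) :=
      (IsGaussian.memLp_two_id (μ := multivariateGaussian μ S)).integrable_norm_pow (by norm_num)
    refine (integrable_const _).add ?_
    simp only [he]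
    exact ((((h1.const_mul 2).add (integrable_const _)).const_mul b).div_const 2)
  refine lt_of_le_of_lt (lintegral_mono fun z => ?_) hint.lintegral_lt_top
  refine (logNeg_antitone (hlow z)).trans ?_
  rw [logNeg_ofReal (by positivity), Real.log_mul hK0.ne' (Real.exp_pos _).ne', Real.log_exp]
  refine ENNReal.ofReal_le_ofReal (max_le ?_ (by positivity))
  linarith [neg_abs_le (Real.log K)]

/-- A prior with constant finite marginals is almost everywhere constant. -/
lemma ae_eq_const_of_marginal_eq {S : Matrix (Fin d) (Fin d) ℝ} (hS : S.PosDef)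
    {π : E → ℝ≥0∞} (hπ : Measurable π) {c : ℝ≥0∞} (hc : c ≠ ⊤)
    (h : ∀ z, marginal π z S = c) : ∀ᵐ y, π y = c := by
  have hSsymm : Sᵀ = S := by
    simpa [Matrix.conjTranspose_eq_transpose_of_trivial] using hS.isHermitian.eq
  have hSdet : IsUnit S.det := hS.det_pos.ne'.isUnit
  have hnd : Measurable fun y : E => normalDensity y 0 S := (continuous_normalDensity 0 S).measurable
  have hconst : ∀ z : E, marginal (fun _ => c) z S = c := by
    intro z
    rw [marginal_eq_lintegral hS measurable_const]
    simp
  -- The marginal at `z = S t` is, up to a factor depending only on `t`, the Laplace transform at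
  -- `t` of the measure with density `N(y; 0, S) π(y)`. Constant marginals thus give the same
  -- transform as a constant prior.
  have htilt : ∀ (t y : E), normalDensity (WithLp.toLp 2 (S *ᵥ t.ofLp)) y S =
      normalDensity y 0 S * Real.exp (inner ℝ y t) *
        Real.exp (-(t.ofLp ⬝ᵥ (S *ᵥ t.ofLp)) / 2) := by
    intro t y
    unfold normalDensity
    have h2 : (WithLp.toLp 2 (S *ᵥ t.ofLp) - y : E).ofLp ⬝ᵥ
        (S⁻¹ *ᵥ (WithLp.toLp 2 (S *ᵥ t.ofLp) - y : E).ofLp) =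
        t.ofLp ⬝ᵥ (S *ᵥ t.ofLp) - 2 * inner ℝ y t +
          (y - 0 : E).ofLp ⬝ᵥ (S⁻¹ *ᵥ (y - 0 : E).ofLp) := by
      have e1 : S⁻¹ *ᵥ (S *ᵥ t.ofLp) = t.ofLp := by
        rw [Matrix.mulVec_mulVec, Matrix.nonsing_inv_mul _ hSdet, Matrix.one_mulVec]
      have e2 : (S *ᵥ t.ofLp) ⬝ᵥ (S⁻¹ *ᵥ y.ofLp) = t.ofLp ⬝ᵥ y.ofLp := by
        rw [Matrix.dotProduct_mulVec, ← Matrix.mulVec_transpose, Matrix.transpose_nonsing_inv,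
          hSsymm, e1]
      have e3 : (inner ℝ y t : ℝ) = t.ofLp ⬝ᵥ y.ofLp := by
        simp [EuclideanSpace.inner_eq_star_dotProduct]
      simp only [WithLp.ofLp_sub, sub_zero, Matrix.mulVec_sub, sub_dotProduct, dotProduct_sub,
        e1, e2, e3]
      rw [dotProduct_comm (S *ᵥ t.ofLp) t.ofLp, dotProduct_comm y.ofLp t.ofLp]
      ring
    rw [h2, mul_assoc, mul_assoc, ← Real.exp_add, ← Real.exp_add]
    congr 2
    ring
  set ρ : (E → ℝ≥0∞) → Measure E := fun p =>
    volume.withDensity fun y => ENNReal.ofReal (normalDensity y 0 S) * p y with hρ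
  have hlap : ∀ {p : E → ℝ≥0∞}, Measurable p → (∀ z, marginal p z S = c) → ∀ t : E,
      ∫⁻ y, ENNReal.ofReal (Real.exp (inner ℝ y t)) ∂(ρ p) =
        ENNReal.ofReal (Real.exp (t.ofLp ⬝ᵥ (S *ᵥ t.ofLp) / 2)) * c := by
    intro p hp hpc t
    rw [hρ]
    simp only
    rw [lintegral_withDensity_eq_lintegral_mul _ (by fun_prop) (by fun_prop),
      ← hpc (WithLp.toLp 2 (S *ᵥ t.ofLp)), marginal, ← lintegral_const_mul' _ _
      ENNReal.ofReal_ne_top]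
    refine lintegral_congr fun y => ?_
    rw [htilt, ← mul_assoc, ← ENNReal.ofReal_mul (by positivity), Pi.mul_apply, mul_right_comm,
      ← ENNReal.ofReal_mul (normalDensity_nonneg _ _ _)]
    congr 2
    have : Real.exp (t.ofLp ⬝ᵥ (S *ᵥ t.ofLp) / 2) *
        Real.exp (-(t.ofLp ⬝ᵥ (S *ᵥ t.ofLp)) / 2) = 1 := by
      rw [← Real.exp_add]; ring_nf; exact Real.exp_zero
    linear_combination (-(normalDensity y 0 S * Real.exp (inner ℝ y t))) * this
  have hfin : ∀ {p : E → ℝ≥0∞}, Measurable p → (∀ z, marginal p z S = c) →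
      IsFiniteMeasure (ρ p) := by
    intro p hp hpc
    refine ⟨?_⟩
    have := hlap hp hpc 0
    simp only [inner_zero_right, Real.exp_zero, ENNReal.ofReal_one, lintegral_const, one_mul]
      at this
    rw [this]
    exact ENNReal.mul_lt_top ENNReal.ofReal_lt_top hc.lt_top
  have hfin₁ := hfin hπ h
  have hfin₂ := hfin measurable_const hconst
  have heq : ρ π = ρ fun _ => c := by
    refine Measure.ext_of_lintegral_exp_inner_eq (fun t => ?_) (fun t => ?_)
    · rw [hlap hπ h]
      exact (ENNReal.mul_lt_top ENNReal.ofReal_lt_top hc.lt_top).ne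
    · rw [hlap hπ h, hlap measurable_const hconst]
  have hne : ∫⁻ y, ENNReal.ofReal (normalDensity y 0 S) * π y ≠ ⊤ := by
    have := hfin₁.measure_univ_lt_top
    rw [hρ] at this
    simp only [withDensity_apply _ MeasurableSet.univ, Measure.restrict_univ] at this
    exact this.ne
  have hae := (withDensity_eq_iff (by fun_prop) (by fun_prop) hne).mp heq
  filter_upwards [hae] with y hy
  have h0 : ENNReal.ofReal (normalDensity y 0 S) ≠ 0 := by
    simpa using normalDensity_pos y 0 hS
  exact (ENNReal.mul_right_inj h0 ENNReal.ofReal_ne_top).mp hy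

end Covariance

/-! ### Extended real differences and marginals as Gaussian averages -/

section EntropyComparison

open ProbabilityTheory

/-- In `EReal`, `⊤ - ⊤ = ⊥`. The hypothesis `hb` rules out `a₁ = b₁ = ⊤` with `b₂` finite, where `h`
holds but the conclusion can fail. -/
lemma EReal.coe_ennreal_sub_le_sub {a₁ a₂ b₁ b₂ : ℝ≥0∞} (h : a₂ + b₁ ≤ a₁ + b₂) (hb : b₁ ≤ b₂) :
    (a₂ : EReal) - b₂ ≤ a₁ - b₁ := by
  rcases eq_or_ne b₂ ⊤ with rfl | hb₂
  · simp
  have hb₁ : b₁ ≠ ⊤ := (hb.trans_lt hb₂.lt_top).ne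
  lift b₂ to NNReal using hb₂
  lift b₁ to NNReal using hb₁
  rcases eq_or_ne a₁ ⊤ with rfl | ha₁
  · have : ((⊤ : ℝ≥0∞) : EReal) - ((b₁ : ℝ≥0∞) : EReal) = ⊤ := by
      rw [EReal.coe_ennreal_top]
      exact EReal.top_sub_coe (b₁ : ℝ)
    rw [this]
    exact le_top
  have ha₂ : a₂ ≠ ⊤ := by
    have : a₁ + b₂ < ⊤ := by simpa using ha₁.lt_top
    exact ((le_self_add.trans h).trans_lt this).ne
  lift a₁ to NNReal using ha₁
  lift a₂ to NNReal using ha₂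
  have h' : (a₂ : ℝ) + b₁ ≤ a₁ + b₂ := by exact_mod_cast h
  change ((a₂ : ℝ) : EReal) - ((b₂ : ℝ) : EReal) ≤ ((a₁ : ℝ) : EReal) - ((b₁ : ℝ) : EReal)
  rw [← EReal.coe_sub, ← EReal.coe_sub, EReal.coe_le_coe_iff]
  linarith

lemma EReal.add_le_add_of_coe_ennreal_sub_le_sub {a₁ a₂ b₁ b₂ : ℝ≥0∞} (ha₁ : a₁ ≠ ⊤) (ha₂ : a₂ ≠ ⊤)
    (hb₁ : b₁ ≠ ⊤) (hb₂ : b₂ ≠ ⊤) (h : (a₁ : EReal) - b₁ ≤ a₂ - b₂) : a₁ + b₂ ≤ a₂ + b₁ := by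
  lift a₁ to NNReal using ha₁
  lift a₂ to NNReal using ha₂
  lift b₁ to NNReal using hb₁
  lift b₂ to NNReal using hb₂
  change ((a₁ : ℝ) : EReal) - ((b₁ : ℝ) : EReal) ≤ ((a₂ : ℝ) : EReal) - ((b₂ : ℝ) : EReal) at h
  rw [← EReal.coe_sub, ← EReal.coe_sub, EReal.coe_le_coe_iff] at h
  have h' : (a₁ : ℝ) + b₂ ≤ a₂ + b₁ := by linarith
  exact_mod_cast h'

lemma EReal.coe_ennreal_sub_lt_top {a b : ℝ≥0∞} (ha : a ≠ ⊤) : (a : EReal) - b < ⊤ := by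
  have h := EReal.coe_ennreal_sub_le_sub (a₁ := a) (a₂ := a) (b₁ := 0) (b₂ := b) (by simp) zero_le
  refine h.trans_lt ?_
  rw [EReal.coe_ennreal_zero, sub_zero]
  exact lt_top_iff_ne_top.mpr (by simpa using ha)

lemma EReal.bot_lt_coe_ennreal_sub {a b : ℝ≥0∞} (hb : b ≠ ⊤) : ⊥ < (a : EReal) - b := by
  have h := EReal.coe_ennreal_sub_le_sub (a₁ := a) (a₂ := 0) (b₁ := b) (b₂ := b)
    (by rw [zero_add]; exact le_add_self) le_rfl
  refine lt_of_lt_of_le ?_ h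
  lift b to NNReal using hb
  change ⊥ < ((0 : ℝ≥0∞) : EReal) - ((b : ℝ) : EReal)
  rw [EReal.coe_ennreal_zero, zero_sub, ← EReal.coe_neg]
  exact EReal.bot_lt_coe _

variable {d : ℕ}

local notation "E" => EuclideanSpace ℝ (Fin d)

lemma measurable_marginal {π : E → ℝ≥0∞} (hπ : Measurable π) (S : Matrix (Fin d) (Fin d) ℝ) :
    Measurable fun z => marginal π z S := by
  unfold marginal
  refine Measurable.lintegral_prod_right' (f := fun p : E × E =>
    ENNReal.ofReal (normalDensity p.1 p.2 S) * π p.2) ?_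
  have : Continuous fun p : E × E => normalDensity p.1 p.2 S := by
    unfold normalDensity
    simp only [dotProduct, Matrix.mulVec]
    fun_prop
  exact this.measurable.ennreal_ofReal.mul (hπ.comp measurable_snd)

lemma phi_eq {S : Matrix (Fin d) (Fin d) ℝ} (hS : S.PosDef) {π : E → ℝ≥0∞} (hπ : Measurable π)
    (μ : E) :
    phi π μ S = ((∫⁻ z, logPos (marginal π z S) ∂(multivariateGaussian μ S) : ℝ≥0∞) : EReal) -
      ((∫⁻ z, logNeg (marginal π z S) ∂(multivariateGaussian μ S) : ℝ≥0∞) : EReal) := by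
  have hm := measurable_marginal hπ S
  have hp : Measurable fun z => logPos (marginal π z S) := measurable_logPos.comp hm
  have hn : Measurable fun z => logNeg (marginal π z S) := measurable_logNeg.comp hm
  rw [lintegral_multivariateGaussian hS μ hp, lintegral_multivariateGaussian hS μ hn]
  rfl

lemma lintegral_multivariateGaussian_eq_zero_mean (S : Matrix (Fin d) (Fin d) ℝ) (w : E)
    {h : E → ℝ≥0∞} (hh : Measurable h) :
    ∫⁻ z, h z ∂(multivariateGaussian w S) = ∫⁻ v, h (w + v) ∂(multivariateGaussian 0 S) := by
  rw [multivariateGaussian, multivariateGaussian, lintegral_map hh (by fun_prop),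
    lintegral_map (by fun_prop) (by fun_prop)]
  simp

lemma marginal_add {S D A : Matrix (Fin d) (Fin d) ℝ} (hS : S.PosDef) (hSD : (S + D).PosDef)
    (hA : A * Aᵀ = D) {π : E → ℝ≥0∞} (hπ : Measurable π) (z : E) :
    marginal π z (S + D) =
      ∫⁻ y, ∫⁻ u, π (y + Matrix.toEuclideanLin A u) ∂(stdGaussian E)
        ∂(multivariateGaussian z S) := by
  rw [marginal_eq_lintegral hSD hπ, lintegral_multivariateGaussian_add hS.posSemidef hA z hπ]
  rfl

lemma continuous_toEuclideanLin (A : Matrix (Fin d) (Fin d) ℝ) :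
    Continuous (Matrix.toEuclideanLin A : E → E) :=
  (Matrix.toEuclideanLin A).continuous_of_finiteDimensional

/-- By Tonelli, averaging over the noise before or after forming the marginal is the same. -/
lemma lintegral_marginal_comp {S D A : Matrix (Fin d) (Fin d) ℝ} (hS : S.PosDef)
    (hSD : (S + D).PosDef) (hA : A * Aᵀ = D) {π : E → ℝ≥0∞} (hπ : Measurable π) (z : E) :
    ∫⁻ u, marginal π (z + Matrix.toEuclideanLin A u) S ∂(stdGaussian E) =
      marginal π z (S + D) := by
  have hL := continuous_toEuclideanLin A
  have hLm : Measurable (Matrix.toEuclideanLin A : E → E) := hL.measurable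
  rw [marginal_add hS hSD hA hπ]
  have h1 : Measurable fun y => ∫⁻ u, π (y + Matrix.toEuclideanLin A u) ∂(stdGaussian E) :=
    Measurable.lintegral_prod_right' (f := fun p : E × E => π (p.1 + Matrix.toEuclideanLin A p.2))
      (by fun_prop)
  rw [lintegral_multivariateGaussian_eq_zero_mean S z h1]
  simp_rw [marginal_eq_lintegral hS hπ, lintegral_multivariateGaussian_eq_zero_mean S
    (z + _) hπ]
  rw [lintegral_lintegral_swap]
  · simp_rw [add_right_comm z]
  · have : Measurable fun p : E × E => π (z + Matrix.toEuclideanLin A p.1 + p.2) := by fun_prop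
    exact this.aemeasurable

/-! ### The inequality for `phi` and its equality case -/

section Comparison

variable {S₁ S₂ A : Matrix (Fin d) (Fin d) ℝ} {π : EuclideanSpace ℝ (Fin d) → ℝ≥0∞}

lemma marginal_le_marginal (hS₁ : S₁.PosDef) (hS₂ : S₂.PosDef) (hA : A * Aᵀ = S₂ - S₁)
    (hπ : Measurable π)
    (hsm : ∀ x, ∫⁻ u, π (x + Matrix.toEuclideanLin A u) ∂(stdGaussian E) ≤ π x) (z : E) :
    marginal π z S₂ ≤ marginal π z S₁ := by
  have e : S₂ = S₁ + (S₂ - S₁) := by abel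
  conv_lhs => rw [e]
  rw [marginal_add hS₁ (by rwa [← e]) hA hπ, marginal_eq_lintegral hS₁ hπ]
  exact lintegral_mono hsm

/-- The super-mean-value inequality is used twice: to replace `S₂` by `S₁` under the integral, and
again once the average has become `marginal π z S₂`. This is the input to Jensen's inequality. -/
lemma lintegral_marginal_le (hS₁ : S₁.PosDef) (hS₂ : S₂.PosDef) (hA : A * Aᵀ = S₂ - S₁)
    (hπ : Measurable π)
    (hsm : ∀ x, ∫⁻ u, π (x + Matrix.toEuclideanLin A u) ∂(stdGaussian E) ≤ π x) (z : E) :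
    ∫⁻ u, marginal π (z + Matrix.toEuclideanLin A u) S₂ ∂(stdGaussian E) ≤ marginal π z S₁ := by
  have e : S₂ = S₁ + (S₂ - S₁) := by abel
  refine (lintegral_mono fun u => marginal_le_marginal hS₁ hS₂ hA hπ hsm _).trans ?_
  rw [lintegral_marginal_comp hS₁ (by rwa [← e]) hA hπ, ← e]
  exact marginal_le_marginal hS₁ hS₂ hA hπ hsm z

lemma lintegral_multivariateGaussian_of_le (hS₁ : S₁.PosDef) (hA : A * Aᵀ = S₂ - S₁) (μ : E)
    {h : E → ℝ≥0∞} (hh : Measurable h) :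
    ∫⁻ z, h z ∂(multivariateGaussian μ S₂) =
      ∫⁻ z, ∫⁻ u, h (z + Matrix.toEuclideanLin A u) ∂(stdGaussian E)
        ∂(multivariateGaussian μ S₁) := by
  have e : S₂ = S₁ + (S₂ - S₁) := by abel
  conv_lhs => rw [e]
  exact lintegral_multivariateGaussian_add hS₁.posSemidef hA μ hh

lemma measurable_lintegral_comp_add (A : Matrix (Fin d) (Fin d) ℝ) {h : E → ℝ≥0∞}
    (hh : Measurable h) :
    Measurable fun z => ∫⁻ u, h (z + Matrix.toEuclideanLin A u) ∂(stdGaussian E) := by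
  have hLm : Measurable (Matrix.toEuclideanLin A : E → E) := (continuous_toEuclideanLin A).measurable
  exact Measurable.lintegral_prod_right' (f := fun p : E × E =>
    h (p.1 + Matrix.toEuclideanLin A p.2)) (by fun_prop)

lemma lintegral_logNeg_marginal_le (hS₁ : S₁.PosDef) (hS₂ : S₂.PosDef) (hA : A * Aᵀ = S₂ - S₁)
    (hπ : Measurable π)
    (hsm : ∀ x, ∫⁻ u, π (x + Matrix.toEuclideanLin A u) ∂(stdGaussian E) ≤ π x) (μ : E) :
    ∫⁻ z, logNeg (marginal π z S₁) ∂(multivariateGaussian μ S₁) ≤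
      ∫⁻ z, logNeg (marginal π z S₂) ∂(multivariateGaussian μ S₂) := by
  have hm := measurable_marginal hπ S₂
  have hn : Measurable fun z => logNeg (marginal π z S₂) := measurable_logNeg.comp hm
  rw [lintegral_multivariateGaussian_of_le hS₁ hA μ (hn)]
  have hLm : Measurable (Matrix.toEuclideanLin A : E → E) := (continuous_toEuclideanLin A).measurable
  exact lintegral_mono fun z => logNeg_le_lintegral_logNeg
    (X := fun u => marginal π (z + Matrix.toEuclideanLin A u) S₂) (by fun_prop)
    (lintegral_marginal_le hS₁ hS₂ hA hπ hsm z)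

lemma lintegral_logPos_marginal_add_le (hS₁ : S₁.PosDef) (hS₂ : S₂.PosDef)
    (hA : A * Aᵀ = S₂ - S₁) (hπ : Measurable π)
    (hsm : ∀ x, ∫⁻ u, π (x + Matrix.toEuclideanLin A u) ∂(stdGaussian E) ≤ π x) (μ : E) :
    ∫⁻ z, logPos (marginal π z S₂) ∂(multivariateGaussian μ S₂) +
      ∫⁻ z, logNeg (marginal π z S₁) ∂(multivariateGaussian μ S₁) ≤
    ∫⁻ z, logPos (marginal π z S₁) ∂(multivariateGaussian μ S₁) +
      ∫⁻ z, logNeg (marginal π z S₂) ∂(multivariateGaussian μ S₂) := by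
  have hm₁ := measurable_marginal hπ S₁
  have hm₂ := measurable_marginal hπ S₂
  have hp₁ : Measurable fun z => logPos (marginal π z S₁) := measurable_logPos.comp hm₁
  have hp₂ : Measurable fun z => logPos (marginal π z S₂) := measurable_logPos.comp hm₂
  have hn₁ : Measurable fun z => logNeg (marginal π z S₁) := measurable_logNeg.comp hm₁
  have hn₂ : Measurable fun z => logNeg (marginal π z S₂) := measurable_logNeg.comp hm₂
  have hLm : Measurable (Matrix.toEuclideanLin A : E → E) := (continuous_toEuclideanLin A).measurable
  rw [lintegral_multivariateGaussian_of_le hS₁ hA μ hn₂,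
    lintegral_multivariateGaussian_of_le hS₁ hA μ hp₂,
    ← lintegral_add_right _ hn₁,
    ← lintegral_add_left hp₁]
  exact lintegral_mono fun z => lintegral_logPos_add_logNeg_le
    (X := fun u => marginal π (z + Matrix.toEuclideanLin A u) S₂) (by fun_prop)
    (lintegral_marginal_le hS₁ hS₂ hA hπ hsm z)

/-- The comparison of `phi` under Gaussian super-mean-value inequalities. -/
lemma phi_le_phi (hS₁ : S₁.PosDef) (hS₂ : S₂.PosDef) (hA : A * Aᵀ = S₂ - S₁)
    (hπ : Measurable π)
    (hsm : ∀ x, ∫⁻ u, π (x + Matrix.toEuclideanLin A u) ∂(stdGaussian E) ≤ π x) (μ : E) :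
    phi π μ S₂ ≤ phi π μ S₁ := by
  rw [phi_eq hS₁ hπ, phi_eq hS₂ hπ]
  exact EReal.coe_ennreal_sub_le_sub (lintegral_logPos_marginal_add_le hS₁ hS₂ hA hπ hsm μ)
    (lintegral_logNeg_marginal_le hS₁ hS₂ hA hπ hsm μ)

/-- The positive part of `log m` is at most `m`, and the mean of `m(·; S)` under `N(μ, S)` is `m(μ;
S + S)`. -/
lemma lintegral_logPos_marginal_lt_top {S : Matrix (Fin d) (Fin d) ℝ} (hS : S.PosDef)
    (hπ : Measurable π) (μ : E) (hfin : marginal π μ (S + S) < ⊤) :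
    ∫⁻ z, logPos (marginal π z S) ∂(multivariateGaussian μ S) < ⊤ := by
  refine lt_of_le_of_lt (lintegral_mono fun z => logPos_le_self _) ?_
  have hQ : CFC.sqrt S * (CFC.sqrt S)ᵀ = S := by
    rw [isSymm_sqrt, CFC.sqrt_mul_sqrt_self _ hS.posSemidef.nonneg]
  rw [marginal_add hS (hS.add hS) hQ hπ] at hfin
  refine lt_of_le_of_lt (lintegral_mono fun z => ?_) hfin
  rw [marginal_eq_lintegral hS hπ, multivariateGaussian, lintegral_map hπ (by fun_prop)]
  rfl

/-- The law of `z + A u` has a strictly positive density, so its null sets are Lebesgue null. -/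
lemma ae_of_ae_stdGaussian {D : Matrix (Fin d) (Fin d) ℝ} (hA : A * Aᵀ = D) (hD : D.PosDef)
    {h : E → ℝ≥0∞} (hh : Measurable h) {c : ℝ≥0∞} {z : E}
    (hae : ∀ᵐ u ∂(stdGaussian E), h (z + Matrix.toEuclideanLin A u) = c) : ∀ᵐ y, h y = c := by
  classical
  set F : E → ℝ≥0∞ := (h ⁻¹' {c}ᶜ).indicator 1 with hF
  have hFm : Measurable F := measurable_one.indicator (hh (measurableSet_singleton c).compl)
  have h1 : ∫⁻ u, F (z + Matrix.toEuclideanLin A u) ∂(stdGaussian E) = 0 := by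
    rw [lintegral_congr_ae (g := fun _ => 0)]
    · simp
    · filter_upwards [hae] with u hu
      simp [hF, hu]
  have h2 := lintegral_stdGaussian_comp_add_smul hA z 1 hFm
  simp only [one_smul, one_pow, h1, lintegral_multivariateGaussian hD z hFm] at h2
  have hnd : Measurable fun y : E => normalDensity y z D := (continuous_normalDensity z D).measurable
  have h3 := (lintegral_eq_zero_iff (by fun_prop)).mp h2.symm
  filter_upwards [h3] with y hy
  by_contra hne
  have h4 : F y = 1 := Set.indicator_of_mem (by simpa using hne) _
  have h5 := normalDensity_pos y z hD
  simp [h4, not_le.mpr h5] at hy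

lemma lintegral_stdGaussian_of_ae_eq {D : Matrix (Fin d) (Fin d) ℝ} (hA : A * Aᵀ = D)
    (hD : D.PosDef) {h : E → ℝ≥0∞} (hh : Measurable h) {c : ℝ≥0∞} (hae : ∀ᵐ y, h y = c) (w : E) :
    ∫⁻ u, h (w + Matrix.toEuclideanLin A u) ∂(stdGaussian E) = c := by
  have h2 := lintegral_stdGaussian_comp_add_smul hA w 1 hh
  simp only [one_smul, one_pow] at h2
  rw [h2, lintegral_multivariateGaussian hD w hh,
    lintegral_congr_ae (g := fun y => ENNReal.ofReal (normalDensity y w D) * c)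
      (hae.mono fun y hy => by simp [hy]),
    ← lintegral_multivariateGaussian hD w measurable_const]
  simp

/-- Equality in the comparison of `phi` forces the prior to be constant. -/
lemma phi_lt_phi (hS₁ : S₁.PosDef) (hS₂ : S₂.PosDef) (hD : (S₂ - S₁).PosDef)
    (hA : A * Aᵀ = S₂ - S₁) (hπ : Measurable π) (hlsc : LowerSemicontinuous π)
    (hsm : ∀ x, ∫⁻ u, π (x + Matrix.toEuclideanLin A u) ∂(stdGaussian E) ≤ π x) (μ : E)
    (hfin : ∀ z, marginal π z S₁ ≠ ⊤)
    (ha₁ : ∫⁻ z, logPos (marginal π z S₁) ∂(multivariateGaussian μ S₁) ≠ ⊤)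
    (hb₂ : ∫⁻ z, logNeg (marginal π z S₂) ∂(multivariateGaussian μ S₂) ≠ ⊤)
    (hne : ¬ ∃ c, ∀ ν, π ν = c) : phi π μ S₂ < phi π μ S₁ := by
  by_contra! hcon
  apply hne
  have hb := lintegral_logNeg_marginal_le hS₁ hS₂ hA hπ hsm μ
  have hab := lintegral_logPos_marginal_add_le hS₁ hS₂ hA hπ hsm μ
  have hb₁ : ∫⁻ z, logNeg (marginal π z S₁) ∂(multivariateGaussian μ S₁) ≠ ⊤ :=
    (hb.trans_lt hb₂.lt_top).ne
  have ha₂ : ∫⁻ z, logPos (marginal π z S₂) ∂(multivariateGaussian μ S₂) ≠ ⊤ :=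
    ((le_self_add.trans hab).trans_lt (ENNReal.add_lt_top.mpr ⟨ha₁.lt_top, hb₂.lt_top⟩)).ne
  rw [phi_eq hS₁ hπ, phi_eq hS₂ hπ] at hcon
  have hrev := EReal.add_le_add_of_coe_ennreal_sub_le_sub ha₁ ha₂ hb₁ hb₂ hcon
  have hm₁ := measurable_marginal hπ S₁
  have hm₂ := measurable_marginal hπ S₂
  have hp₁ : Measurable fun z => logPos (marginal π z S₁) := measurable_logPos.comp hm₁
  have hp₂ : Measurable fun z => logPos (marginal π z S₂) := measurable_logPos.comp hm₂
  have hn₁ : Measurable fun z => logNeg (marginal π z S₁) := measurable_logNeg.comp hm₁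
  have hn₂ : Measurable fun z => logNeg (marginal π z S₂) := measurable_logNeg.comp hm₂
  have hLm : Measurable (Matrix.toEuclideanLin A : E → E) := (continuous_toEuclideanLin A).measurable
  have hN : Measurable fun z => ∫⁻ u, logNeg (marginal π (z + Matrix.toEuclideanLin A u) S₂)
      ∂(stdGaussian E) := measurable_lintegral_comp_add A hn₂
  have hsum : ∫⁻ z, logPos (marginal π z S₂) ∂(multivariateGaussian μ S₂) +
      ∫⁻ z, logNeg (marginal π z S₁) ∂(multivariateGaussian μ S₁) ≠ ⊤ :=
    ENNReal.add_ne_top.mpr ⟨ha₂, hb₁⟩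
  rw [lintegral_multivariateGaussian_of_le hS₁ hA μ hn₂] at hrev hb₂
  rw [lintegral_multivariateGaussian_of_le hS₁ hA μ hp₂,
    ← lintegral_add_right _ hn₁] at hrev hsum
  rw [← lintegral_add_left hp₁] at hrev
  have hae := ae_eq_of_ae_le_of_lintegral_le (Filter.Eventually.of_forall fun z =>
    lintegral_logPos_add_logNeg_le
      (X := fun u => marginal π (z + Matrix.toEuclideanLin A u) S₂) (by fun_prop)
      (lintegral_marginal_le hS₁ hS₂ hA hπ hsm z)) hsum
    ((hp₁.add hN).aemeasurable) hrev
  have hae₁ := ae_lt_top hn₁ hb₁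
  have hae₂ := ae_lt_top hN hb₂
  -- A single `z` with equality in Jensen suffices, since the noise `A u` reaches the whole space.
  obtain ⟨z, hz, hz₁, hz₂⟩ := (hae.and (hae₁.and hae₂)).exists
  have hc0 : marginal π z S₁ ≠ 0 := by
    intro h0
    simp [h0, logNeg_zero] at hz₁
  set c := marginal π z S₁ with hc
  have hct : c ≠ ⊤ := hfin z
  have hX := ae_eq_of_lintegral_logPos_add_logNeg_eq
    (X := fun u => marginal π (z + Matrix.toEuclideanLin A u) S₂) (by fun_prop)
    (lintegral_marginal_le hS₁ hS₂ hA hπ hsm z) hc0 hct hz₂.ne hz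
  have hm₂c := ae_of_ae_stdGaussian hA hD hm₂ hX
  have hS₃ : (S₂ + (S₂ - S₁)).PosDef := hS₂.add hD
  -- One more smoothing turns constancy almost everywhere into constancy everywhere, without any
  -- continuity of marginals.
  have hm₃ : ∀ w, marginal π w (S₂ + (S₂ - S₁)) = c := fun w => by
    rw [← lintegral_marginal_comp hS₂ hS₃ hA hπ]
    exact lintegral_stdGaussian_of_ae_eq hA hD hm₂ hm₂c w
  have hπc := ae_eq_const_of_marginal_eq hS₃ hπ hct hm₃
  -- Upper bound: by lower semicontinuity `{π > c}` is open, and it is null. Lower bound: the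
  -- super-mean-value inequality.
  refine ⟨c, fun ν => le_antisymm ?_ ?_⟩
  · have hopen : IsOpen {y | c < π y} := hlsc.isOpen_preimage c
    have hnull : volume {y | c < π y} = 0 := by
      refine measure_mono_null (fun y hy => ?_) (ae_iff.mp hπc)
      exact (ne_of_gt hy)
    have hempty := (hopen.measure_eq_zero_iff volume).mp hnull
    by_contra! hlt
    exact (Set.eq_empty_iff_forall_notMem.mp hempty) ν hlt
  · rw [← lintegral_stdGaussian_of_ae_eq hA hD hπ hπc ν]
    exact hsm ν

end Comparison

end EntropyComparison

theorem proposition1 {d : ℕ} (S₁ S₂ U : Matrix (Fin d) (Fin d) ℝ) (l : Fin d → ℝ)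
    (hS₁ : S₁.PosDef) (hS₂ : S₂.PosDef) (hle : (S₂ - S₁).PosSemidef)
    (hU : U ∈ Matrix.orthogonalGroup (Fin d) ℝ)
    (hdiag : CFC.sqrt S₁ * S₂⁻¹ * CFC.sqrt S₁ = Uᵀ * Matrix.diagonal l * U)
    (π : EuclideanSpace ℝ (Fin d) → ℝ≥0∞) (hπ : Measurable π) :
    -- Nondegenerate case: `S₂ - S₁` is positive definite, that is, `A*` is invertible.
    ((S₂ - S₁).PosDef →
      SuperharmonicOn
        (fun μ => (π (Matrix.toEuclideanLin (starMatrix S₁ U l) μ) : EReal)) Set.univ →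
      ∀ μ : EuclideanSpace ℝ (Fin d),
        phi π μ S₂ ≤ phi π μ S₁ ∧
        phi π μ S₁ < ⊤ ∧
        ((∃ ν, π ν ≠ 0) → ⊥ < phi π μ S₂) ∧
        ((¬ ∃ c, ∀ ν, π ν = c) → phi π μ S₂ < phi π μ S₁)) ∧
    -- General case: `S₂ - S₁` is positive semidefinite, and the superharmonicity is required
    -- on every translate of the range of `A*`.
    ((∀ ν : EuclideanSpace ℝ (Fin d), SuperharmonicOn
        (fun μ => (π (ν + Matrix.toEuclideanLin (starMatrix S₁ U l) μ) : EReal)) Set.univ) →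
      ∀ μ : EuclideanSpace ℝ (Fin d), phi π μ S₂ ≤ phi π μ S₁) := by
  have hA := starMatrix_mul_transpose hS₁ hS₂ hle hU hdiag
  set A := starMatrix S₁ U l
  have hLc := continuous_toEuclideanLin A
  have hLm : Measurable (Matrix.toEuclideanLin A) := hLc.measurable
  constructor
  · intro hD hsuper μ
    have hAdet : IsUnit A.det := by
      have h : A.det * A.det = (S₂ - S₁).det := by rw [← hA, Matrix.det_mul, Matrix.det_transpose]
      refine isUnit_iff_ne_zero.mpr fun h0 => hD.det_pos.ne' ?_
      rw [← h, h0, zero_mul]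
    have hright : ∀ x, Matrix.toEuclideanLin A (Matrix.toEuclideanLin A⁻¹ x) = x := by
      intro x
      ext i
      simp [Matrix.toLpLin_apply, Matrix.mulVec_mulVec, Matrix.mul_nonsing_inv _ hAdet]
    have hscale : ∀ x (s : ℝ), 0 ≤ s → ∫⁻ u, π (x + Matrix.toEuclideanLin A (s • u))
        ∂(ProbabilityTheory.stdGaussian (EuclideanSpace ℝ (Fin d))) ≤ π x := by
      intro x s hs
      have h := hsuper.lintegral_stdGaussian_le (hπ.comp hLm) (Matrix.toEuclideanLin A⁻¹ x) hs
      simpa only [Function.comp_apply, map_add, hright] using h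
    have hsm : ∀ x, ∫⁻ u, π (x + Matrix.toEuclideanLin A u)
        ∂(ProbabilityTheory.stdGaussian (EuclideanSpace ℝ (Fin d))) ≤ π x := by
      intro x
      simpa only [one_smul] using hscale x 1 zero_le_one
    have hlsc : LowerSemicontinuous π := by
      have h1 := (lowerSemicontinuousOn_univ_iff.mp hsuper.lowerSemicontinuousOn).comp
        (continuous_toEuclideanLin A⁻¹)
      intro x y hy
      have h2 := h1 x (y : EReal) (by simpa [hright] using hy)
      filter_upwards [h2] with w hw
      simpa [hright] using hw
    -- One point where `π` is finite bounds its Gaussian averages there at every scale, hence all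
    -- marginals.
    obtain ⟨y, -, hy⟩ := hsuper.exists_ne_top 0 (Set.mem_univ _)
    have hy' : π (Matrix.toEuclideanLin A y) < ⊤ := by
      rw [lt_top_iff_ne_top]
      intro h
      exact hy (by simp [h])
    have hfin : ∀ {S : Matrix (Fin d) (Fin d) ℝ}, S.PosDef → ∀ z, marginal π z S < ⊤ :=
      fun hS z => marginal_lt_top hA hD hS hπ (fun s hs => (hscale _ s hs).trans_lt hy') z
    have ha₁ := lintegral_logPos_marginal_lt_top hS₁ hπ μ (hfin (hS₁.add hS₁) μ)
    have hb₂ : (∃ ν, π ν ≠ 0) → ∫⁻ z, logNeg (marginal π z S₂)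
        ∂(ProbabilityTheory.multivariateGaussian μ S₂) < ⊤ := by
      rintro ⟨ν, hν⟩
      obtain ⟨c, hc0, hcν⟩ := ENNReal.lt_iff_exists_nnreal_btwn.mp (pos_iff_ne_zero.mpr hν)
      -- Lower semicontinuity spreads positivity at one point to a ball.
      obtain ⟨r, hr, hball⟩ := Metric.isOpen_iff.mp (hlsc.isOpen_preimage (c : ℝ≥0∞)) ν hcν
      refine lintegral_logNeg_marginal_lt_top hS₂ (y₀ := ν) hr (c := c) (by exact_mod_cast hc0)
        (fun y hy => ?_) μ
      rw [ENNReal.ofReal_coe_nnreal]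
      exact (hball hy).le
    refine ⟨phi_le_phi hS₁ hS₂ hA hπ hsm μ, ?_, fun hν => ?_, fun hne => ?_⟩
    · rw [phi_eq hS₁ hπ]
      exact EReal.coe_ennreal_sub_lt_top ha₁.ne
    · rw [phi_eq hS₂ hπ]
      exact EReal.bot_lt_coe_ennreal_sub (hb₂ hν).ne
    · have hν : ∃ ν, π ν ≠ 0 := by
        by_contra! h
        exact hne ⟨0, h⟩
      exact phi_lt_phi hS₁ hS₂ hD hA hπ hlsc hsm μ (fun z => (hfin hS₁ z).ne) ha₁.ne
        (hb₂ hν).ne hne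
  · intro hsuper μ
    refine phi_le_phi hS₁ hS₂ hA hπ (fun x => ?_) μ
    -- Taking the translate through `x` itself and evaluating at `0` avoids inverting `A*`.
    have h := (hsuper x).lintegral_stdGaussian_le (hπ.comp (by fun_prop)) 0 zero_le_one
    simpa only [Function.comp_apply, one_smul, zero_add, map_zero, add_zero] using h
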